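/- Let $D_i, D_o, L, M \ge 1$ be integers. Consider the fully connected network with $L$ hidden layers of width $M$, input $x\in\mathbb{R}^{D_i}$ and output in $\mathbb{R}^{D_o}$, $$z_1=\tfrac1{\sqrt{D_i}}W_1x+b_1,\qquad z_\ell=\tfrac1{\sqrt M}W_\ell\,\phi(z_{\ell-1})+b_\ell\ (2\le \ell\le L),\qquad f_\theta(x)=\tfrac1{\sqrt M}W_{L+1}\phi(z_L)+b_{L+1},$$ where $\phi:\mathbb{R}\to\mathbb{R}$ acts entrywise and $\theta$ collects all entries of $W_1,\dots,W_{L+1}$ and $b_1,\dots,b_{L+1}$. Suppose that $\phi$ is $1$-Lipschitz and that its even part is constant: $\tfrac12(\phi(a)+\phi(-a))=\alpha$ for all $a\in\mathbb{R}$, for some $\alpha\in\mathbb{R}$. Let $P=\mathcal{N}(0,I)$ and let $Q=\mathcal{N}(\mu,\operatorname{diag}(\sigma^2))$, with arbitrary means and arbitrary positive variances, be distributions of $\theta$, and let $\mathrm{KL}=\mathrm{KL}(Q,P)$ be the Kullback–Leibler divergence, which is finite. Put $\tilde f_\theta(x)=f_\theta(x)-\tfrac{\alpha}{\sqrt M}W_{L+1}\mathbf{1}-b_{L+1}$.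 Then, for every $x\in\mathbb{R}^{D_i}$, the entrywise squares $\tilde f_\theta(x)^2$ are integrable under $Q$ and under $P$, and $$\bigl\|\mathbb{E}_Q[\tilde f_\theta(x)^2]-\mathbb{E}_P[\tilde f_\theta(x)^2]\bigr\|_\infty\le c_1\,L^{1/2}\,\rho_{\alpha,M}^{\,L}\;\frac{\alpha^2+1+\frac1{D_i}\|x\|_2^2}{\sqrt M}\;\sqrt{\mathrm{KL}}\;\bigl(\max(2\,\mathrm{KL},1)\bigr)^{L+\frac12},$$ where $c_1=16+25\sqrt2\in(51,52)$ and $\rho_{\alpha,M}\in(17,97)$ is given by $$\rho_{\alpha,M}=\begin{cases}12(2+\sqrt{2\pi}) & \alpha=0,\ M<36,\\ \tfrac23(13+2\sqrt{43}) & \alpha=0,\ M\ge 36,\\ 28+\sqrt{793} & \alpha\ne0,\ M<36,\\ 48+\sqrt{2353} & \alpha\neq 0,\ M\ge 36.\end{cases}$$ The same bound also holds with the two values for $\alpha\ne0$ interchanged, that is, with $48+\sqrt{2353}$ for $M<36$ and $28+\sqrt{793}$ for $M\ge36$. -/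

import Mathlib

open MeasureTheory ProbabilityTheory
open scoped NNReal ENNReal

/-- Index type of the scalar parameters of a fully connected network with input dimension `Di`,
output dimension `Do`, and `L` hidden layers of width `M`. -/
inductive ParamIdx (Di Do M L : ℕ) : Type
  | inWeight (i : Fin M) (j : Fin Di)
  | inBias (i : Fin M)
  /-- `hidWeight l` is the weight matrix between hidden layers `l + 1` and `l + 2` (1-based). -/
  | hidWeight (l : Fin (L - 1)) (i j : Fin M)
  | hidBias (l : Fin (L - 1)) (i : Fin M)
  | outWeight (i : Fin Do) (j : Fin M)
  | outBias (i : Fin Do)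
  deriving DecidableEq, Fintype

/-- A concrete value of all the parameters of the network. -/
abbrev Params (Di Do M L : ℕ) : Type := ParamIdx Di Do M L → ℝ

noncomputable section

/-- Preactivations: `preact φ θ x l _` is the vector `z_{l+1}` of hidden layer `l + 1` (1-based). -/
def preact {Di Do M L : ℕ} (φ : ℝ → ℝ) (θ : Params Di Do M L)
    (x : EuclideanSpace ℝ (Fin Di)) : (l : ℕ) → l < L → Fin M → ℝ
  | 0, _ => fun i =>
      1 / √(Di : ℝ) * ∑ j, θ (.inWeight i j) * x j + θ (.inBias i)
  | l + 1, h => fun i =>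
      1 / √(M : ℝ) *
          ∑ j, θ (.hidWeight ⟨l, by omega⟩ i j) * φ (preact φ θ x l (by omega) j)
        + θ (.hidBias ⟨l, by omega⟩ i)

/-- The network output `f_θ(x) = M^{-1/2} W_{L+1} φ(z_L) + b_{L+1}`. -/
def network {Di Do M L : ℕ} (hL : 1 ≤ L) (φ : ℝ → ℝ) (θ : Params Di Do M L)
    (x : EuclideanSpace ℝ (Fin Di)) : Fin Do → ℝ := fun i =>
  1 / √(M : ℝ) *
      ∑ j, θ (.outWeight i j) * φ (preact φ θ x (L - 1) (by omega) j)
    + θ (.outBias i)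

/-- The network output without the final bias and the constant `α` of the last activation:
`f_θ(x) - (α / √M) W_{L+1} 1 - b_{L+1}`. -/
def networkTilde {Di Do M L : ℕ} (hL : 1 ≤ L) (φ : ℝ → ℝ) (α : ℝ) (θ : Params Di Do M L)
    (x : EuclideanSpace ℝ (Fin Di)) : Fin Do → ℝ := fun i =>
  network hL φ θ x i - α / √(M : ℝ) * ∑ j, θ (.outWeight i j) - θ (.outBias i)

/-- The even part of a function. -/
def evenPart (φ : ℝ → ℝ) (a : ℝ) : ℝ := (φ a + φ (-a)) / 2

/-- The factorized Gaussian distribution with means `μ i` and variances `v i`. -/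
def meanFieldGaussian {ι : Type} [Fintype ι] (μ : ι → ℝ) (v : ι → ℝ≥0) : Measure (ι → ℝ) :=
  Measure.pi fun i => gaussianReal (μ i) (v i)

/-- The standard Gaussian prior `N(0, I)`. -/
def stdPrior (ι : Type) [Fintype ι] : Measure (ι → ℝ) :=
  meanFieldGaussian (fun _ => 0) (fun _ => 1)

/-- The constant `c₁`. -/
def cOne : ℝ := 16 + 25 * √2

/-- The constant `ρ_{α,M}`, with the case distinction for `α ≠ 0` as in the displayed table. -/
def rho (α : ℝ) (M : ℕ) : ℝ :=
  if α = 0 then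
    if M < 36 then 12 * (2 + √(2 * Real.pi)) else 2 / 3 * (13 + 2 * √43)
  else
    if M < 36 then 28 + √793 else 48 + √2353

/-- The variant of `ρ_{α,M}` in which the two values for `α ≠ 0` are interchanged. -/
def rhoSwap (α : ℝ) (M : ℕ) : ℝ :=
  if α = 0 then
    if M < 36 then 12 * (2 + √(2 * Real.pi)) else 2 / 3 * (13 + 2 * √43)
  else
    if M < 36 then 48 + √2353 else 28 + √793

end

/-!
Couple the two laws through one parameter vector: if `ω` is drawn from `P = N(0, I)`, then `μ + σ ω`
is drawn from `Q`, and `∑ (μ² + (σ - 1)²) ≤ 2 KL`, because `(√w - 1)² ≤ w - 1 - log w`.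

The weights `ω` of a layer are centred, have variance one and are independent of its inputs. Hence
second moments of preactivations are sums of second moments of inputs, and the squared distance
between the two coupled networks satisfies a linear recursion from layer to layer, driven by
`∑ (μ² + (σ - 1)²)` times the total second moment of the inputs.

The sum of the squared distances over the `M` units of a layer is bounded independently of `M`, so
the factor `1 / √M` in front of the output layer makes its contribution to the squared distance of
order `1 / M`. The mean `μ` of the output weights has to gain the same factor, and this is where the
parity of `φ` enters: flipping the signs of the weights into one unit of the last hidden layer
changes the sign of its activation `φ - α` only, so these `M` activations are pairwise orthogonal,
and the second moment of `∑ μ_j (φ(z_j) - α) / √M` is of order `‖μ‖² / M`.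
-/

section SecondMoment

variable {Ω : Type*} [MeasurableSpace Ω] {P : Measure Ω} {g h : Ω → ℝ}

lemma integral_sq_nonneg (P : Measure Ω) (g : Ω → ℝ) : 0 ≤ ∫ ω, g ω ^ 2 ∂P :=
  integral_nonneg fun _ => sq_nonneg _

lemma integral_add_sq (hg : MemLp g 2 P) (hh : MemLp h 2 P) :
    ∫ ω, (g ω + h ω) ^ 2 ∂P =
      ∫ ω, g ω ^ 2 ∂P + 2 * ∫ ω, g ω * h ω ∂P + ∫ ω, h ω ^ 2 ∂P := by
  have hcross : Integrable (fun ω => g ω * h ω) P := hg.integrable_mul hh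
  rw [← integral_const_mul, ← integral_add hg.integrable_sq (hcross.const_mul 2),
    ← integral_add (by exact hg.integrable_sq.add (hcross.const_mul 2)) hh.integrable_sq]
  simp only [add_sq, mul_assoc]

lemma integral_add_sq_le (hg : MemLp g 2 P) (hh : MemLp h 2 P) :
    ∫ ω, (g ω + h ω) ^ 2 ∂P ≤ 2 * ∫ ω, g ω ^ 2 ∂P + 2 * ∫ ω, h ω ^ 2 ∂P := by
  rw [← integral_const_mul, ← integral_const_mul,
    ← integral_add (hg.integrable_sq.const_mul 2) (hh.integrable_sq.const_mul 2)]
  exact integral_mono (hg.add hh).integrable_sq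
    ((hg.integrable_sq.const_mul 2).add (hh.integrable_sq.const_mul 2))
    fun ω => add_sq_le.trans_eq (mul_add _ _ _)

lemma integral_sq_le_add_integral_sub_sq (hg : MemLp g 2 P) (hh : MemLp h 2 P) :
    ∫ ω, g ω ^ 2 ∂P ≤ 2 * ∫ ω, h ω ^ 2 ∂P + 2 * ∫ ω, (g ω - h ω) ^ 2 ∂P := by
  simpa using integral_add_sq_le hh (hg.sub hh)

lemma integral_sum_mul_sq_le {J : Type*} [Fintype J] (m : J → ℝ) {a : J → Ω → ℝ}
    (ha : ∀ j, MemLp (a j) 2 P) :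
    ∫ ω, (∑ j, m j * a j ω) ^ 2 ∂P ≤ (∑ j, m j ^ 2) * ∑ j, ∫ ω, a j ω ^ 2 ∂P := by
  rw [← integral_finsetSum _ fun j _ => (ha j).integrable_sq, ← integral_const_mul]
  exact integral_mono (memLp_finsetSum _ fun j _ => (ha j).const_mul (m j)).integrable_sq
    ((integrable_finsetSum _ fun j _ => (ha j).integrable_sq).const_mul _)
    fun ω => Finset.sum_mul_sq_le_sq_mul_sq _ _ _

lemma integral_sum_sq_of_orthogonal {J : Type*} [Fintype J] {a : J → Ω → ℝ}
    (ha : ∀ j, MemLp (a j) 2 P) (horth : Pairwise fun i j => ∫ ω, a i ω * a j ω ∂P = 0) :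
    ∫ ω, (∑ j, a j ω) ^ 2 ∂P = ∑ j, ∫ ω, a j ω ^ 2 ∂P := by
  have hint (i j : J) : Integrable (fun ω => a i ω * a j ω) P := (ha i).integrable_mul (ha j)
  simp only [sq, Finset.sum_mul_sum]
  rw [integral_finsetSum _ fun i _ => integrable_finsetSum _ fun j _ => hint i j]
  refine Finset.sum_congr rfl fun i _ => ?_
  rw [integral_finsetSum _ fun j _ => hint i j]
  exact Finset.sum_eq_single i (fun j _ hji => horth hji.symm) (by simp)

lemma abs_integral_mul_le (hg : MemLp g 2 P) (hh : MemLp h 2 P) :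
    |∫ ω, g ω * h ω ∂P| ≤ √(∫ ω, g ω ^ 2 ∂P) * √(∫ ω, h ω ^ 2 ∂P) := by
  have hölder := integral_mul_norm_le_Lp_mul_Lq Real.HolderConjugate.two_two
    (by simpa using hg) (by simpa using hh)
  simp only [Real.rpow_two, Real.norm_eq_abs, sq_abs, ← Real.sqrt_eq_rpow] at hölder
  calc |∫ ω, g ω * h ω ∂P| ≤ ∫ ω, |g ω * h ω| ∂P := abs_integral_le_integral_abs
    _ = ∫ ω, |g ω| * |h ω| ∂P := by simp only [abs_mul]
    _ ≤ _ := hölder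

lemma abs_integral_sq_sub_integral_sq_le (hg : MemLp g 2 P) (hh : MemLp h 2 P) :
    |(∫ ω, g ω ^ 2 ∂P) - ∫ ω, h ω ^ 2 ∂P| ≤
      ∫ ω, (g ω - h ω) ^ 2 ∂P
        + 2 * (√(∫ ω, (g ω - h ω) ^ 2 ∂P) * √(∫ ω, h ω ^ 2 ∂P)) := by
  have hsub : MemLp (fun ω => g ω - h ω) 2 P := hg.sub hh
  have hexpand := integral_add_sq hsub hh
  simp only [sub_add_cancel] at hexpand
  rw [hexpand, add_sub_cancel_right]
  refine (abs_add_le _ _).trans ?_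
  rw [abs_of_nonneg (integral_sq_nonneg P _), abs_mul, abs_two]
  gcongr
  exact abs_integral_mul_le hsub hh

end SecondMoment

section Activation

variable {Ω : Type*} [MeasurableSpace Ω] {P : Measure Ω} {g h : Ω → ℝ} {φ : ℝ → ℝ} {K : ℝ≥0}

lemma sub_sq_le_of_lipschitzWith (hφ : LipschitzWith K φ) (a b : ℝ) :
    (φ a - φ b) ^ 2 ≤ K ^ 2 * (a - b) ^ 2 := by
  rw [← mul_pow, sq_le_sq, abs_mul, NNReal.abs_eq]
  simpa [Real.dist_eq] using hφ.dist_le_mul a b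

lemma evenPart_const_apply_zero {α : ℝ} (hα : ∀ a, evenPart φ a = α) : φ 0 = α := by
  simpa [evenPart] using hα 0

lemma sub_neg_of_evenPart_const {α : ℝ} (hα : ∀ a, evenPart φ a = α) (a : ℝ) :
    φ (-a) - α = -(φ a - α) := by
  linarith [hα a, show evenPart φ a = (φ a + φ (-a)) / 2 from rfl]

lemma memLp_comp_of_lipschitzWith [IsFiniteMeasure P] (hφ : LipschitzWith K φ)
    {p : ℝ≥0∞} (hg : MemLp g p P) : MemLp (fun ω => φ (g ω)) p P := by
  have hφ0 : LipschitzWith K fun a => φ a - φ 0 := by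
    simpa using hφ.sub (LipschitzWith.const (φ 0))
  have hsum := (hφ0.comp_memLp (by simp) hg).add (memLp_const (φ 0))
  exact hsum.ae_eq (.of_forall fun ω => by simp)

lemma integral_comp_sub_comp_sq_le (hφ : LipschitzWith K φ) (hg : MemLp g 2 P)
    (hh : MemLp h 2 P) :
    ∫ ω, (φ (g ω) - φ (h ω)) ^ 2 ∂P ≤ K ^ 2 * ∫ ω, (g ω - h ω) ^ 2 ∂P := by
  rw [← integral_const_mul]
  exact integral_mono_of_nonneg (.of_forall fun _ => sq_nonneg _)
    ((hg.sub hh).integrable_sq.const_mul _)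
    (.of_forall fun _ => sub_sq_le_of_lipschitzWith hφ _ _)

lemma integral_comp_sub_const_sq_le (hφ : LipschitzWith K φ) (hg : MemLp g 2 P) :
    ∫ ω, (φ (g ω) - φ 0) ^ 2 ∂P ≤ K ^ 2 * ∫ ω, g ω ^ 2 ∂P := by
  simpa using integral_comp_sub_comp_sq_le hφ hg MemLp.zero

lemma integral_comp_sq_le [IsProbabilityMeasure P] (hφ : LipschitzWith K φ) (hg : MemLp g 2 P) :
    ∫ ω, φ (g ω) ^ 2 ∂P ≤ 2 * φ 0 ^ 2 + 2 * (K ^ 2 * ∫ ω, g ω ^ 2 ∂P) := by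
  have hcentred := integral_comp_sub_const_sq_le hφ hg
  have hsplit := integral_sq_le_add_integral_sub_sq (memLp_comp_of_lipschitzWith hφ hg)
    (memLp_const (μ := P) (φ 0))
  simp only [integral_const, probReal_univ, one_smul] at hsplit
  linarith

end Activation

section FreshCoordinate

/-- Probability measures on `ℝ` with mean `0` and variance `1`. -/
class IsStandardized (ν : Measure ℝ) : Prop extends IsProbabilityMeasure ν where
  memLp_id : MemLp id 2 ν
  integral_id : ∫ y, y ∂ν = 0
  integral_sq : ∫ y, y ^ 2 ∂ν = 1

variable {ι : Type*} {S T : Set ι} {g h : (ι → ℝ) → ℝ} {k : ι}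

/-- `AdaptedL2 P S g` says that the random variable `g` is square integrable under `P` and depends
only on the coordinates in `S`. -/
structure AdaptedL2 (P : Measure (ι → ℝ)) (S : Set ι) (g : (ι → ℝ) → ℝ) : Prop where
  measurable : Measurable g
  dependsOn : DependsOn g S
  memLp : MemLp g 2 P

namespace AdaptedL2

variable {P : Measure (ι → ℝ)}

lemma mono (hg : AdaptedL2 P S g) (hST : S ⊆ T) : AdaptedL2 P T g :=
  ⟨hg.measurable, hg.dependsOn.mono hST, hg.memLp⟩

lemma const [IsFiniteMeasure P] (S : Set ι) (c : ℝ) : AdaptedL2 P S fun _ => c :=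
  ⟨measurable_const, fun _ _ _ => rfl, memLp_const c⟩

lemma add (hg : AdaptedL2 P S g) (hh : AdaptedL2 P S h) : AdaptedL2 P S fun ω => g ω + h ω :=
  ⟨hg.measurable.add hh.measurable,
    fun _ _ hω => congrArg₂ (· + ·) (hg.dependsOn hω) (hh.dependsOn hω), hg.memLp.add hh.memLp⟩

lemma const_mul (c : ℝ) (hg : AdaptedL2 P S g) : AdaptedL2 P S fun ω => c * g ω :=
  ⟨hg.measurable.const_mul c, fun _ _ hω => congrArg (c * ·) (hg.dependsOn hω),
    hg.memLp.const_mul c⟩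

lemma sub (hg : AdaptedL2 P S g) (hh : AdaptedL2 P S h) : AdaptedL2 P S fun ω => g ω - h ω := by
  simpa [sub_eq_add_neg] using hg.add (hh.const_mul (-1))

lemma sum {J : Type*} {s : Finset J} {a : J → (ι → ℝ) → ℝ} (ha : ∀ j ∈ s, AdaptedL2 P S (a j)) :
    AdaptedL2 P S fun ω => ∑ j ∈ s, a j ω :=
  ⟨Finset.measurable_sum s fun j hj => (ha j hj).measurable,
    fun _ _ hω => Finset.sum_congr rfl fun j hj => (ha j hj).dependsOn hω,
    memLp_finsetSum s fun j hj => (ha j hj).memLp⟩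

lemma lipschitz_comp [IsFiniteMeasure P] {φ : ℝ → ℝ} {K : ℝ≥0} (hφ : LipschitzWith K φ)
    (hg : AdaptedL2 P S g) : AdaptedL2 P S fun ω => φ (g ω) :=
  ⟨hφ.continuous.measurable.comp hg.measurable, fun _ _ hω => congrArg φ (hg.dependsOn hω),
    memLp_comp_of_lipschitzWith hφ hg.memLp⟩

end AdaptedL2

variable [Fintype ι] {ν : ι → Measure ℝ}

lemma indepFun_eval_of_dependsOn [∀ k, IsProbabilityMeasure (ν k)] (hk : k ∉ S)
    (hg : Measurable g) (hgS : DependsOn g S) :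
    IndepFun (fun ω => ω k) g (Measure.pi ν) := by
  classical
  let extend (y : ({k}ᶜ : Finset ι) → ℝ) (i : ι) : ℝ :=
    if hi : i ∈ ({k}ᶜ : Finset ι) then y ⟨i, hi⟩ else 0
  have hextend : Measurable extend := measurable_pi_lambda _ fun i => by
    by_cases hi : i ∈ ({k}ᶜ : Finset ι)
    · simpa only [extend, dif_pos hi] using measurable_pi_apply _
    · simp only [extend, dif_neg hi, measurable_const]
  have hfactor : g = (g ∘ extend) ∘ fun ω (i : ({k}ᶜ : Finset ι)) => ω i := by
    funext ω
    refine hgS fun i hi => ?_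
    have hik : i ∈ ({k}ᶜ : Finset ι) := by simpa using ne_of_mem_of_not_mem hi hk
    simp only [extend, dif_pos hik]
  have hindep := (iIndepFun_pi (μ := ν) (X := fun _ => id) fun _ => aemeasurable_id).indepFun_finset
    {k} {k}ᶜ disjoint_compl_right fun i => measurable_pi_apply i
  rw [hfactor]
  exact hindep.comp (measurable_pi_apply ⟨k, Finset.mem_singleton_self k⟩) (hg.comp hextend)

variable [∀ k, IsStandardized (ν k)]

lemma memLp_eval_pi (k : ι) : MemLp (fun ω => ω k) 2 (Measure.pi ν) :=
  (IsStandardized.memLp_id (ν := ν k)).comp_measurePreserving (measurePreserving_eval ν k)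

lemma integral_eval_pi (k : ι) : ∫ ω, ω k ∂Measure.pi ν = 0 :=
  integral_eval.trans IsStandardized.integral_id

lemma integral_eval_sq_pi (k : ι) : ∫ ω, ω k ^ 2 ∂Measure.pi ν = 1 :=
  (integral_comp_eval (μ := ν) (i := k) (f := fun y => y ^ 2) (by fun_prop)).trans
    IsStandardized.integral_sq

namespace AdaptedL2

lemma eval_mul (hk : k ∉ S) (hg : AdaptedL2 (Measure.pi ν) S g) :
    AdaptedL2 (Measure.pi ν) (insert k S) fun ω => ω k * g ω where
  measurable := (measurable_pi_apply k).mul hg.measurable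
  dependsOn _ _ hω := congrArg₂ (· * ·) (hω k (Set.mem_insert k S))
    (hg.dependsOn fun i hi => hω i (Set.mem_insert_of_mem k hi))
  memLp := by
    refine (memLp_two_iff_integrable_sq
      ((measurable_pi_apply k).mul hg.measurable).aestronglyMeasurable).2 ?_
    have hindep := (indepFun_eval_of_dependsOn (ν := ν) hk hg.measurable hg.dependsOn).comp
      (measurable_id.pow_const 2) (measurable_id.pow_const 2)
    refine (hindep.integrable_mul (memLp_eval_pi k).integrable_sq hg.memLp.integrable_sq).congr
      (.of_forall fun ω => (mul_pow _ _ _).symm)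

lemma integral_eval_mul_sq (hk : k ∉ S) (hg : AdaptedL2 (Measure.pi ν) S g) :
    ∫ ω, (ω k * g ω) ^ 2 ∂Measure.pi ν = ∫ ω, g ω ^ 2 ∂Measure.pi ν := by
  have hindep := indepFun_eval_of_dependsOn (ν := ν) hk hg.measurable hg.dependsOn
  simp only [mul_pow]
  rw [hindep.integral_fun_comp_mul_comp (f := fun y => y ^ 2) (g := fun y => y ^ 2)
    (measurable_pi_apply k).aemeasurable hg.measurable.aemeasurable (by fun_prop) (by fun_prop),
    integral_eval_sq_pi, one_mul]

lemma integral_mul_eval_mul (hk : k ∉ S) (hg : AdaptedL2 (Measure.pi ν) S g)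
    (hh : AdaptedL2 (Measure.pi ν) S h) :
    ∫ ω, g ω * (ω k * h ω) ∂Measure.pi ν = 0 := by
  have hprod : Measurable fun ω => g ω * h ω := hg.measurable.mul hh.measurable
  have hindep := indepFun_eval_of_dependsOn (ν := ν) hk hprod
    fun _ _ hω => congrArg₂ (· * ·) (hg.dependsOn hω) (hh.dependsOn hω)
  simp only [mul_left_comm (g _)]
  rw [hindep.integral_fun_mul_eq_mul_integral (measurable_pi_apply k).aestronglyMeasurable
    hprod.aestronglyMeasurable, integral_eval_pi, zero_mul]

lemma integral_add_eval_mul_sq (hk : k ∉ S) (hg : AdaptedL2 (Measure.pi ν) S g)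
    (hh : AdaptedL2 (Measure.pi ν) S h) :
    ∫ ω, (g ω + ω k * h ω) ^ 2 ∂Measure.pi ν =
      ∫ ω, g ω ^ 2 ∂Measure.pi ν + ∫ ω, h ω ^ 2 ∂Measure.pi ν := by
  rw [integral_add_sq hg.memLp (hh.eval_mul hk).memLp, integral_mul_eval_mul hk hg hh,
    integral_eval_mul_sq hk hh, mul_zero, add_zero]

variable {J : Type*} {c : (ι → ℝ) → ℝ} {u : J → (ι → ℝ) → ℝ} {κ : J → ι}

lemma add_sum_eval_mul (hc : AdaptedL2 (Measure.pi ν) S c)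
    (hu : ∀ j, AdaptedL2 (Measure.pi ν) S (u j)) (hκ : ∀ j, κ j ∉ S) (s : Finset J) :
    AdaptedL2 (Measure.pi ν) (S ∪ κ '' s) fun ω => c ω + ∑ j ∈ s, ω (κ j) * u j ω :=
  (hc.mono Set.subset_union_left).add <| .sum fun j hj => ((hu j).eval_mul (hκ j)).mono <|
    Set.insert_subset (.inr ⟨j, hj, rfl⟩) Set.subset_union_left

lemma integral_add_sum_eval_mul_sq (hc : AdaptedL2 (Measure.pi ν) S c)
    (hu : ∀ j, AdaptedL2 (Measure.pi ν) S (u j)) (hκ : ∀ j, κ j ∉ S)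
    (hκ_inj : Function.Injective κ) (s : Finset J) :
    ∫ ω, (c ω + ∑ j ∈ s, ω (κ j) * u j ω) ^ 2 ∂Measure.pi ν =
      ∫ ω, c ω ^ 2 ∂Measure.pi ν + ∑ j ∈ s, ∫ ω, u j ω ^ 2 ∂Measure.pi ν := by
  classical
  induction s using Finset.induction_on with
  | empty => simp
  | insert j s hj ih =>
    have hfresh : κ j ∉ S ∪ κ '' s := by simp [hκ j, hκ_inj.eq_iff, hj]
    have hstep := integral_add_eval_mul_sq hfresh (add_sum_eval_mul hc hu hκ s)
      ((hu j).mono Set.subset_union_left)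
    rw [Finset.sum_insert hj, add_left_comm, add_comm, ← ih, ← hstep]
    congr! 3 with ω
    rw [Finset.sum_insert hj]
    ring

lemma integral_sum_affine_sub_sum_sq_le [Fintype J] {a b : J → (ι → ℝ) → ℝ}
    (ha : ∀ j, AdaptedL2 (Measure.pi ν) S (a j)) (hb : ∀ j, AdaptedL2 (Measure.pi ν) S (b j))
    (hκ : ∀ j, κ j ∉ S) (hκ_inj : Function.Injective κ) (m d : J → ℝ) :
    ∫ ω, (∑ j, (m j + d j * ω (κ j)) * a j ω - ∑ j, ω (κ j) * b j ω) ^ 2 ∂Measure.pi ν ≤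
      ∫ ω, (∑ j, m j * a j ω) ^ 2 ∂Measure.pi ν
        + 2 * ∑ j, ∫ ω, (a j ω - b j ω) ^ 2 ∂Measure.pi ν
        + 2 * ∑ j, (d j - 1) ^ 2 * ∫ ω, a j ω ^ 2 ∂Measure.pi ν := by
  have hmean : AdaptedL2 (Measure.pi ν) S fun ω => ∑ j, m j * a j ω :=
    .sum fun j _ => (ha j).const_mul (m j)
  have hincr (j : J) : AdaptedL2 (Measure.pi ν) S fun ω => (d j - 1) * a j ω + (a j ω - b j ω) :=
    ((ha j).const_mul _).add ((ha j).sub (hb j))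
  have hincr_le (j : J) : ∫ ω, ((d j - 1) * a j ω + (a j ω - b j ω)) ^ 2 ∂Measure.pi ν ≤
      2 * ((d j - 1) ^ 2 * ∫ ω, a j ω ^ 2 ∂Measure.pi ν)
        + 2 * ∫ ω, (a j ω - b j ω) ^ 2 ∂Measure.pi ν := by
    simpa only [mul_pow, integral_const_mul] using
      integral_add_sq_le ((ha j).const_mul (d j - 1)).memLp ((ha j).sub (hb j)).memLp
  calc _ = ∫ ω, (∑ j, m j * a j ω
          + ∑ j, ω (κ j) * ((d j - 1) * a j ω + (a j ω - b j ω))) ^ 2 ∂Measure.pi ν := by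
        congr! 3 with ω
        rw [← Finset.sum_sub_distrib, ← Finset.sum_add_distrib]
        exact Finset.sum_congr rfl fun j _ => by ring
    _ = ∫ ω, (∑ j, m j * a j ω) ^ 2 ∂Measure.pi ν
          + ∑ j, ∫ ω, ((d j - 1) * a j ω + (a j ω - b j ω)) ^ 2 ∂Measure.pi ν :=
        integral_add_sum_eval_mul_sq hmean hincr hκ hκ_inj Finset.univ
    _ ≤ ∫ ω, (∑ j, m j * a j ω) ^ 2 ∂Measure.pi ν
          + ∑ j, (2 * ((d j - 1) ^ 2 * ∫ ω, a j ω ^ 2 ∂Measure.pi ν)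
            + 2 * ∫ ω, (a j ω - b j ω) ^ 2 ∂Measure.pi ν) := by
        gcongr with j
        exact hincr_le j
    _ = _ := by
        rw [Finset.sum_add_distrib, ← Finset.mul_sum, ← Finset.mul_sum]
        ring

lemma integral_sum_affine_sub_sum_sq_le_of_le [Fintype J] {a b : J → (ι → ℝ) → ℝ}
    (ha : ∀ j, AdaptedL2 (Measure.pi ν) S (a j)) (hb : ∀ j, AdaptedL2 (Measure.pi ν) S (b j))
    (hκ : ∀ j, κ j ∉ S) (hκ_inj : Function.Injective κ) (m d : J → ℝ) {β : ℝ}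
    (hb_le : ∀ j, ∫ ω, b j ω ^ 2 ∂Measure.pi ν ≤ β)
    (hmb_le : ∫ ω, (∑ j, m j * b j ω) ^ 2 ∂Measure.pi ν ≤ (∑ j, m j ^ 2) * β) :
    ∫ ω, (∑ j, (m j + d j * ω (κ j)) * a j ω - ∑ j, ω (κ j) * b j ω) ^ 2 ∂Measure.pi ν ≤
      2 * ∑ j, ∫ ω, (a j ω - b j ω) ^ 2 ∂Measure.pi ν
        + 4 * (∑ j, (m j ^ 2 + (d j - 1) ^ 2))
          * (β + ∑ j, ∫ ω, (a j ω - b j ω) ^ 2 ∂Measure.pi ν) := by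
  set Δ := ∑ j, ∫ ω, (a j ω - b j ω) ^ 2 ∂Measure.pi ν
  have hmean : ∫ ω, (∑ j, m j * a j ω) ^ 2 ∂Measure.pi ν ≤ 2 * ((∑ j, m j ^ 2) * (β + Δ)) := by
    have hsplit := integral_sq_le_add_integral_sub_sq
      (memLp_finsetSum Finset.univ fun j _ => ((ha j).const_mul (m j)).memLp)
      (memLp_finsetSum Finset.univ fun j _ => ((hb j).const_mul (m j)).memLp)
    have hdiff := integral_sum_mul_sq_le m fun j => ((ha j).sub (hb j)).memLp
    simp only [mul_sub, Finset.sum_sub_distrib] at hdiff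
    linarith
  have hterm (j : J) : ∫ ω, a j ω ^ 2 ∂Measure.pi ν ≤ 2 * (β + Δ) := by
    have hj : ∫ ω, (a j ω - b j ω) ^ 2 ∂Measure.pi ν ≤ Δ :=
      Finset.single_le_sum (f := fun j => ∫ ω, (a j ω - b j ω) ^ 2 ∂Measure.pi ν)
        (fun _ _ => integral_sq_nonneg _ _) (Finset.mem_univ j)
    linarith [integral_sq_le_add_integral_sub_sq (ha j).memLp (hb j).memLp, hb_le j]
  calc _ ≤ 2 * ((∑ j, m j ^ 2) * (β + Δ)) + 2 * Δ + 2 * ∑ j, (d j - 1) ^ 2 * (2 * (β + Δ)) := by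
        refine (integral_sum_affine_sub_sum_sq_le ha hb hκ hκ_inj m d).trans ?_
        gcongr with j
        exact hterm j
    _ ≤ _ := by
        have : 0 ≤ (∑ j, m j ^ 2) * (β + Δ) := by
          linarith [integral_sq_nonneg (Measure.pi ν) fun ω => ∑ j, m j * a j ω]
        rw [← Finset.sum_mul, Finset.sum_add_distrib]
        linarith

end AdaptedL2

end FreshCoordinate

section SignFlip

variable {ι : Type*} {S U : Set ι}

open Classical in
/-- Negation of the coordinates in `U`. -/
noncomputable def signFlip (U : Set ι) (ω : ι → ℝ) : ι → ℝ :=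
  fun k => if k ∈ U then -ω k else ω k

lemma signFlip_apply_of_mem {k : ι} (hk : k ∈ U) (ω : ι → ℝ) : signFlip U ω k = -ω k :=
  if_pos hk

lemma signFlip_apply_of_notMem {k : ι} (hk : k ∉ U) (ω : ι → ℝ) : signFlip U ω k = ω k :=
  if_neg hk

lemma comp_signFlip_of_dependsOn {β : Type*} {g : (ι → ℝ) → β} (hg : DependsOn g S)
    (hSU : Disjoint S U) (ω : ι → ℝ) : g (signFlip U ω) = g ω :=
  hg fun _ hk => signFlip_apply_of_notMem (hSU.notMem_of_mem_left hk) ω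

variable [Fintype ι] {ν : ι → Measure ℝ} [∀ k, SigmaFinite (ν k)] [∀ k, (ν k).IsNegInvariant]

lemma measurePreserving_signFlip (U : Set ι) :
    MeasurePreserving (signFlip U) (Measure.pi ν) (Measure.pi ν) := by
  classical
  refine measurePreserving_pi ν ν (f := fun k y => if k ∈ U then -y else y) fun k => ?_
  by_cases hk : k ∈ U
  · simpa only [hk, if_true] using Measure.measurePreserving_neg (ν k)
  · simpa only [hk, if_false] using! MeasurePreserving.id (ν k)

lemma integral_eq_zero_of_comp_signFlip {f : (ι → ℝ) → ℝ} (hf : Measurable f)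
    (hflip : ∀ ω, f (signFlip U ω) = -f ω) : ∫ ω, f ω ∂Measure.pi ν = 0 := by
  have hT := measurePreserving_signFlip (ν := ν) U
  have hmap := integral_map hT.measurable.aemeasurable hf.aestronglyMeasurable (μ := Measure.pi ν)
  simp only [hT.map_eq, hflip, integral_neg] at hmap
  linarith

lemma integral_odd_comp_sum_mul_odd_comp_sum {I J : Type*} [Fintype J] {κ : I → J → ι}
    {a : J → (ι → ℝ) → ℝ} {ψ : ℝ → ℝ} (hψ : Measurable ψ) (hψ_odd : ψ.Odd)
    (ha_meas : ∀ o, Measurable (a o)) (ha : ∀ o, DependsOn (a o) S)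
    (hκ : ∀ i o, κ i o ∉ S) (hκ_inj : Function.Injective2 κ) {i j : I} (hij : i ≠ j) :
    ∫ ω, ψ (∑ o, ω (κ i o) * a o ω) * ψ (∑ o, ω (κ j o) * a o ω) ∂Measure.pi ν = 0 := by
  have hmeas (i : I) : Measurable fun ω => ψ (∑ o, ω (κ i o) * a o ω) :=
    hψ.comp (Finset.measurable_sum _ fun o _ => (measurable_pi_apply _).mul (ha_meas o))
  have hSU : Disjoint S (Set.range (κ i)) := Set.disjoint_right.2 (Set.forall_mem_range.2 (hκ i))
  have hj_notMem (o : J) : κ j o ∉ Set.range (κ i) := by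
    rintro ⟨o', ho'⟩
    exact hij (hκ_inj ho').1
  refine integral_eq_zero_of_comp_signFlip (U := Set.range (κ i)) ((hmeas i).mul (hmeas j))
    fun ω => ?_
  simp only [signFlip_apply_of_mem (Set.mem_range_self _), signFlip_apply_of_notMem (hj_notMem _),
    comp_signFlip_of_dependsOn (ha _) hSU, neg_mul, Finset.sum_neg_distrib, hψ_odd _]

end SignFlip

section Reparametrization

variable {ι : Type*}

/-- The affine image `μ + σ ω` of a standardized parameter vector `ω`. It has mean `μ` and standard
deviations `|σ k|`, and using the same `ω` for `μ + σ ω` and for `ω` couples the two laws. -/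
def reparam (μ σ : ι → ℝ) (ω : ι → ℝ) : ι → ℝ := fun k => μ k + σ k * ω k

lemma measurable_reparam (μ σ : ι → ℝ) : Measurable (reparam μ σ) := by
  unfold reparam
  fun_prop

lemma reparam_zero_one (ω : ι → ℝ) : reparam 0 1 ω = ω := by
  ext k
  simp [reparam]

/-- Squared Euclidean distance of the parameters `(μ, σ)` of the law of `reparam μ σ` from those of
the standardized law. -/
def affineDeviation [Fintype ι] (μ σ : ι → ℝ) : ℝ := ∑ k, (μ k ^ 2 + (σ k - 1) ^ 2)

lemma affineDeviation_nonneg [Fintype ι] (μ σ : ι → ℝ) : 0 ≤ affineDeviation μ σ :=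
  Finset.sum_nonneg fun _ _ => by positivity

lemma AdaptedL2.sum_reparam_mul [Fintype ι] {ν : ι → Measure ℝ} [∀ k, IsStandardized (ν k)]
    {J : Type*} [Fintype J] {S T : Set ι} {κ : J → ι} {a : J → (ι → ℝ) → ℝ} (μ σ : ι → ℝ)
    (hST : S ⊆ T) (hκS : ∀ j, κ j ∉ S) (hκT : ∀ j, κ j ∈ T)
    (ha : ∀ j, AdaptedL2 (Measure.pi ν) S (a j)) :
    AdaptedL2 (Measure.pi ν) T fun ω => ∑ j, reparam μ σ ω (κ j) * a j ω := by
  simp only [reparam, add_mul, mul_assoc]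
  exact .sum fun j _ => (((ha j).const_mul _).mono hST).add <|
    .const_mul _ <| ((ha j).eval_mul (hκS j)).mono (Set.insert_subset (hκT j) hST)

end Reparametrization

section Layers

variable {Di Do M L : ℕ}

/-- Number of inputs of a unit in hidden layer `l + 1`. As in `preact`, layers are indexed from
`0`, so that index `0` stands for the first hidden layer, which is fed by the network input. -/
def fanIn (Di M : ℕ) : ℕ → ℕ
  | 0 => Di
  | _ + 1 => M

/-- Index of the parameter that multiplies input `o` of unit `i` in hidden layer `l + 1`; the bias
of the unit is the weight of an additional input `none`. -/
def unitParam : (l : ℕ) → l < L → Fin M → Option (Fin (fanIn Di M l)) → ParamIdx Di Do M L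
  | 0, _, i, none => .inBias i
  | 0, _, i, some j => .inWeight i j
  | l + 1, _, i, none => .hidBias ⟨l, by omega⟩ i
  | l + 1, _, i, some j => .hidWeight ⟨l, by omega⟩ i j

/-- Inputs of the units in hidden layer `l + 1`, including the factors `1 / √Di` and `1 / √M` and
the constant input `none` that carries the bias. -/
noncomputable def feature (φ : ℝ → ℝ) (θ : Params Di Do M L) (x : EuclideanSpace ℝ (Fin Di)) :
    (l : ℕ) → l ≤ L → Option (Fin (fanIn Di M l)) → ℝ
  | _, _, none => 1
  | 0, _, some j => 1 / √(Di : ℝ) * x j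
  | l + 1, h, some j => 1 / √(M : ℝ) * φ (preact φ θ x l h j)

lemma preact_eq_sum_feature (φ : ℝ → ℝ) (θ : Params Di Do M L) (x : EuclideanSpace ℝ (Fin Di))
    (l : ℕ) (h : l < L) (i : Fin M) :
    preact φ θ x l h i = ∑ o, θ (unitParam l h i o) * feature φ θ x l h.le o := by
  cases l <;>
  · simp only [preact, Fintype.sum_option, Finset.mul_sum, unitParam, feature, mul_one,
      mul_left_comm (θ _)]
    exact add_comm _ _

/-- Index of the layer that a parameter feeds into; the output layer has index `L`. -/
def ParamIdx.layer : ParamIdx Di Do M L → ℕ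
  | .inWeight _ _ | .inBias _ => 0
  | .hidWeight l _ _ | .hidBias l _ => l + 1
  | .outWeight _ _ | .outBias _ => L

/-- The parameters of the layers with index less than `l`. -/
def paramsBefore (l : ℕ) : Set (ParamIdx Di Do M L) := {k | k.layer < l}

lemma paramsBefore_mono {l m : ℕ} (hlm : l ≤ m) :
    (paramsBefore l : Set (ParamIdx Di Do M L)) ⊆ paramsBefore m :=
  fun _ hk => hk.trans_le hlm

lemma layer_unitParam (l : ℕ) (h : l < L) (i : Fin M) (o : Option (Fin (fanIn Di M l))) :
    (unitParam l h i o : ParamIdx Di Do M L).layer = l := by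
  cases l <;> cases o <;> rfl

lemma unitParam_notMem_paramsBefore (l : ℕ) (h : l < L) (i : Fin M)
    (o : Option (Fin (fanIn Di M l))) :
    (unitParam l h i o : ParamIdx Di Do M L) ∉ paramsBefore l := by
  simp [paramsBefore, layer_unitParam]

lemma unitParam_mem_paramsBefore_succ (l : ℕ) (h : l < L) (i : Fin M)
    (o : Option (Fin (fanIn Di M l))) :
    (unitParam l h i o : ParamIdx Di Do M L) ∈ paramsBefore (l + 1) := by
  simp [paramsBefore, layer_unitParam]

lemma outWeight_notMem_paramsBefore (i : Fin Do) (j : Fin M) :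
    (.outWeight i j : ParamIdx Di Do M L) ∉ paramsBefore L := by
  simp [paramsBefore, ParamIdx.layer]

lemma unitParam_injective2 (l : ℕ) (h : l < L) :
    Function.Injective2 (unitParam (Di := Di) (Do := Do) (M := M) l h) := by
  rintro i i' o o' heq
  cases l <;> cases o <;> cases o' <;> injection heq <;> simp_all

lemma sum_comp_le_sum_of_injective {I K : Type*} [Fintype I] [Fintype K] {e : I → K}
    (he : Function.Injective e) {f : K → ℝ} (hf : ∀ k, 0 ≤ f k) : ∑ i, f (e i) ≤ ∑ k, f k :=
  (Finset.sum_map Finset.univ ⟨e, he⟩ f).symm.trans_le (Finset.sum_le_univ_sum_of_nonneg hf)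

end Layers

section AdaptedLayers

variable {Di Do M L : ℕ} {φ : ℝ → ℝ} {K : ℝ≥0} {ν : ParamIdx Di Do M L → Measure ℝ}
  [∀ k, IsStandardized (ν k)]

lemma adaptedL2_reparam_preact {μ σ : ParamIdx Di Do M L → ℝ} {x : EuclideanSpace ℝ (Fin Di)}
    {l : ℕ} (h : l < L) (i : Fin M)
    (hfeature : ∀ o, AdaptedL2 (Measure.pi ν) (paramsBefore l) fun ω =>
      feature φ (reparam μ σ ω) x l h.le o) :
    AdaptedL2 (Measure.pi ν) (paramsBefore (l + 1)) fun ω =>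
      preact φ (reparam μ σ ω) x l h i := by
  simp only [preact_eq_sum_feature]
  exact .sum_reparam_mul μ σ (paramsBefore_mono l.le_succ) (unitParam_notMem_paramsBefore l h i)
    (unitParam_mem_paramsBefore_succ l h i) hfeature

lemma adaptedL2_reparam_feature (hφ : LipschitzWith K φ) (μ σ : ParamIdx Di Do M L → ℝ)
    (x : EuclideanSpace ℝ (Fin Di)) (l : ℕ) (h : l ≤ L) (o : Option (Fin (fanIn Di M l))) :
    AdaptedL2 (Measure.pi ν) (paramsBefore l) fun ω => feature φ (reparam μ σ ω) x l h o := by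
  induction l with
  | zero => cases o <;> exact .const _ _
  | succ l ih =>
    cases o with
    | none => exact .const _ _
    | some j =>
      exact .const_mul _ <| .lipschitz_comp hφ <|
        adaptedL2_reparam_preact (M := M) h j (ih (Nat.le_of_succ_le h))

end AdaptedLayers

section Energy

variable {Di Do M L : ℕ} {φ : ℝ → ℝ} {K : ℝ≥0} {ν : ParamIdx Di Do M L → Measure ℝ}
  [∀ k, IsStandardized (ν k)]

lemma adaptedL2_feature (hφ : LipschitzWith K φ) (x : EuclideanSpace ℝ (Fin Di)) (l : ℕ)
    (h : l ≤ L) (o : Option (Fin (fanIn Di M l))) :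
    AdaptedL2 (Measure.pi ν) (paramsBefore l) fun ω => feature φ ω x l h o := by
  simpa only [reparam_zero_one] using adaptedL2_reparam_feature hφ 0 1 x l h o

lemma adaptedL2_preact (hφ : LipschitzWith K φ) (x : EuclideanSpace ℝ (Fin Di)) (l : ℕ)
    (h : l < L) (i : Fin M) :
    AdaptedL2 (Measure.pi ν) (paramsBefore (l + 1)) fun ω => preact φ ω x l h i := by
  simpa only [reparam_zero_one] using
    adaptedL2_reparam_preact h i (adaptedL2_reparam_feature hφ 0 1 x l h.le)

/-- Total second moment of the inputs of a unit in hidden layer `l + 1`, for parameters drawn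
from `P`. -/
noncomputable def featureEnergy (P : Measure (Params Di Do M L)) (φ : ℝ → ℝ)
    (x : EuclideanSpace ℝ (Fin Di)) (l : ℕ) (h : l ≤ L) : ℝ :=
  ∑ o, ∫ ω, feature φ ω x l h o ^ 2 ∂P

lemma featureEnergy_nonneg (P : Measure (Params Di Do M L)) (φ : ℝ → ℝ)
    (x : EuclideanSpace ℝ (Fin Di)) (l : ℕ) (h : l ≤ L) : 0 ≤ featureEnergy P φ x l h :=
  Finset.sum_nonneg fun _ _ => integral_sq_nonneg _ _

/-- The factor `α² + 1 + ‖x‖² / Di` through which the bounds depend on the network input. -/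
noncomputable def inputScale (α : ℝ) (x : EuclideanSpace ℝ (Fin Di)) : ℝ :=
  α ^ 2 + 1 + 1 / (Di : ℝ) * ‖x‖ ^ 2

lemma inputScale_pos (α : ℝ) (x : EuclideanSpace ℝ (Fin Di)) : 0 < inputScale α x := by
  unfold inputScale
  positivity

lemma featureEnergy_zero (P : Measure (Params Di Do M L)) [IsProbabilityMeasure P] (φ : ℝ → ℝ)
    (x : EuclideanSpace ℝ (Fin Di)) :
    featureEnergy P φ x 0 L.zero_le = 1 + 1 / (Di : ℝ) * ‖x‖ ^ 2 := by
  simp only [featureEnergy, Fintype.sum_option, feature, integral_const, probReal_univ, one_smul,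
    one_pow, mul_pow, div_pow, Real.sq_sqrt (Nat.cast_nonneg _), EuclideanSpace.real_norm_sq_eq,
    Finset.mul_sum]
  rfl

lemma featureEnergy_succ (P : Measure (Params Di Do M L)) [IsProbabilityMeasure P] (φ : ℝ → ℝ)
    (x : EuclideanSpace ℝ (Fin Di)) (l : ℕ) (h : l < L) :
    featureEnergy P φ x (l + 1) h =
      1 + 1 / (M : ℝ) * ∑ j, ∫ ω, φ (preact φ ω x l h j) ^ 2 ∂P := by
  simp only [featureEnergy, Fintype.sum_option, feature, integral_const, probReal_univ, one_smul,
    one_pow, mul_pow, div_pow, Real.sq_sqrt (Nat.cast_nonneg _), integral_const_mul,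
    Finset.mul_sum]
  rfl

lemma integral_preact_sq (hφ : LipschitzWith K φ) (x : EuclideanSpace ℝ (Fin Di)) (l : ℕ)
    (h : l < L) (i : Fin M) :
    ∫ ω, preact φ ω x l h i ^ 2 ∂Measure.pi ν = featureEnergy (Measure.pi ν) φ x l h.le := by
  simpa [preact_eq_sum_feature, featureEnergy] using
    AdaptedL2.integral_add_sum_eval_mul_sq (.const (paramsBefore l) 0)
      (adaptedL2_feature (ν := ν) hφ x l h.le) (unitParam_notMem_paramsBefore l h i)
      ((unitParam_injective2 l h).right i) Finset.univ

lemma featureEnergy_succ_le (hφ : LipschitzWith 1 φ) (x : EuclideanSpace ℝ (Fin Di)) (l : ℕ)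
    (h : l < L) :
    featureEnergy (Measure.pi ν) φ x (l + 1) h ≤
      1 + 2 * φ 0 ^ 2 + 2 * featureEnergy (Measure.pi ν) φ x l h.le := by
  have hunit (j : Fin M) : ∫ ω, φ (preact φ ω x l h j) ^ 2 ∂Measure.pi ν ≤
      2 * φ 0 ^ 2 + 2 * featureEnergy (Measure.pi ν) φ x l h.le := by
    simpa [integral_preact_sq hφ] using
      integral_comp_sq_le hφ (adaptedL2_preact (ν := ν) hφ x l h j).memLp
  have hsum := Finset.sum_le_card_nsmul Finset.univ _ _ fun j _ => hunit j
  rw [Finset.card_univ, Fintype.card_fin, nsmul_eq_mul] at hsum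
  rw [featureEnergy_succ, add_assoc, one_div]
  gcongr
  exact inv_mul_le_of_le_mul₀ M.cast_nonneg
    (add_nonneg (by positivity) (mul_nonneg zero_le_two (featureEnergy_nonneg ..))) hsum

lemma featureEnergy_le (hφ : LipschitzWith 1 φ) (x : EuclideanSpace ℝ (Fin Di)) (l : ℕ)
    (h : l ≤ L) :
    featureEnergy (Measure.pi ν) φ x l h ≤ 2 ^ (l + 1) * inputScale (φ 0) x := by
  suffices hdouble : featureEnergy (Measure.pi ν) φ x l h + 2 * φ 0 ^ 2 + 1 ≤
      2 ^ (l + 1) * inputScale (φ 0) x by linarith [sq_nonneg (φ 0)]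
  induction l with
  | zero =>
    rw [featureEnergy_zero, inputScale]
    have : 0 ≤ 1 / (Di : ℝ) * ‖x‖ ^ 2 := by positivity
    linarith
  | succ l ih =>
    rw [pow_succ _ (l + 1), mul_right_comm]
    linarith [featureEnergy_succ_le (ν := ν) hφ x l h, ih (Nat.le_of_succ_le h)]

end Energy

section Coupling

variable {Di Do M L : ℕ} {φ : ℝ → ℝ} {ν : ParamIdx Di Do M L → Measure ℝ}
  [∀ k, IsStandardized (ν k)]

/-- Total squared distance in `L²(P)` between the inputs of a unit in hidden layer `l + 1` for the
parameters `reparam μ σ ω` and for the parameters `ω`. -/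
noncomputable def featureGap (P : Measure (Params Di Do M L)) (φ : ℝ → ℝ)
    (μ σ : ParamIdx Di Do M L → ℝ) (x : EuclideanSpace ℝ (Fin Di)) (l : ℕ) (h : l ≤ L) : ℝ :=
  ∑ o, ∫ ω, (feature φ (reparam μ σ ω) x l h o - feature φ ω x l h o) ^ 2 ∂P

/-- Total squared distance in `L²(P)` between the preactivations of hidden layer `l + 1` for the
parameters `reparam μ σ ω` and for the parameters `ω`. -/
noncomputable def preactGap (P : Measure (Params Di Do M L)) (φ : ℝ → ℝ)
    (μ σ : ParamIdx Di Do M L → ℝ) (x : EuclideanSpace ℝ (Fin Di)) (l : ℕ) (h : l < L) : ℝ :=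
  ∑ i, ∫ ω, (preact φ (reparam μ σ ω) x l h i - preact φ ω x l h i) ^ 2 ∂P

variable (μ σ : ParamIdx Di Do M L → ℝ)

lemma preactGap_nonneg (P : Measure (Params Di Do M L)) (φ : ℝ → ℝ)
    (x : EuclideanSpace ℝ (Fin Di)) (l : ℕ) (h : l < L) : 0 ≤ preactGap P φ μ σ x l h :=
  Finset.sum_nonneg fun _ _ => integral_sq_nonneg _ _

lemma featureGap_nonneg (P : Measure (Params Di Do M L)) (φ : ℝ → ℝ)
    (x : EuclideanSpace ℝ (Fin Di)) (l : ℕ) (h : l ≤ L) : 0 ≤ featureGap P φ μ σ x l h :=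
  Finset.sum_nonneg fun _ _ => integral_sq_nonneg _ _

lemma featureGap_zero (P : Measure (Params Di Do M L)) (φ : ℝ → ℝ)
    (x : EuclideanSpace ℝ (Fin Di)) : featureGap P φ μ σ x 0 L.zero_le = 0 := by
  simp [featureGap, Fintype.sum_option, feature]

lemma featureGap_succ (P : Measure (Params Di Do M L)) (φ : ℝ → ℝ)
    (x : EuclideanSpace ℝ (Fin Di)) (l : ℕ) (h : l < L) :
    featureGap P φ μ σ x (l + 1) h = 1 / (M : ℝ) * ∑ j, ∫ ω,
      (φ (preact φ (reparam μ σ ω) x l h j) - φ (preact φ ω x l h j)) ^ 2 ∂P := by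
  simp only [featureGap, Fintype.sum_option, feature, ← mul_sub, mul_pow, div_pow, one_pow,
    Real.sq_sqrt (Nat.cast_nonneg _), integral_const_mul, Finset.mul_sum, sub_self,
    zero_pow two_ne_zero, integral_zero, zero_add]
  rfl

lemma featureGap_succ_le (hφ : LipschitzWith 1 φ) (x : EuclideanSpace ℝ (Fin Di)) (l : ℕ)
    (h : l < L) :
    featureGap (Measure.pi ν) φ μ σ x (l + 1) h ≤
      1 / (M : ℝ) * preactGap (Measure.pi ν) φ μ σ x l h := by
  rw [featureGap_succ]
  refine mul_le_mul_of_nonneg_left (Finset.sum_le_sum fun j _ => ?_) (by positivity)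
  simpa using integral_comp_sub_comp_sq_le hφ
    (adaptedL2_reparam_preact h j (adaptedL2_reparam_feature hφ μ σ x l h.le)).memLp
    (adaptedL2_preact (ν := ν) hφ x l h j).memLp

lemma preactGap_le (hφ : LipschitzWith 1 φ) (x : EuclideanSpace ℝ (Fin Di)) (l : ℕ) (h : l < L) :
    preactGap (Measure.pi ν) φ μ σ x l h ≤
      2 * (M * featureGap (Measure.pi ν) φ μ σ x l h.le)
        + 4 * affineDeviation μ σ * (featureEnergy (Measure.pi ν) φ x l h.le
          + featureGap (Measure.pi ν) φ μ σ x l h.le) := by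
  set F := featureEnergy (Measure.pi ν) φ x l h.le
  set d := featureGap (Measure.pi ν) φ μ σ x l h.le
  have hF_nonneg : 0 ≤ F := featureEnergy_nonneg ..
  have hd_nonneg : 0 ≤ d := featureGap_nonneg ..
  have ha := adaptedL2_feature (ν := ν) hφ x l h.le
  have hunit (i : Fin M) :
      ∫ ω, (preact φ (reparam μ σ ω) x l h i - preact φ ω x l h i) ^ 2 ∂Measure.pi ν ≤
        2 * d + 4 * (∑ o, (μ (unitParam l h i o) ^ 2 + (σ (unitParam l h i o) - 1) ^ 2))
          * (F + d) := by
    simp only [preact_eq_sum_feature, reparam]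
    exact AdaptedL2.integral_sum_affine_sub_sum_sq_le_of_le
      (adaptedL2_reparam_feature hφ μ σ x l h.le) ha (unitParam_notMem_paramsBefore l h i)
      ((unitParam_injective2 l h).right i) _ _
      (fun o => Finset.single_le_sum (f := fun o => ∫ ω, feature φ ω x l h.le o ^ 2 ∂Measure.pi ν)
        (fun _ _ => integral_sq_nonneg _ _) (Finset.mem_univ o))
      (integral_sum_mul_sq_le _ fun o => (ha o).memLp)
  have hdev : ∑ i, ∑ o, (μ (unitParam l h i o) ^ 2 + (σ (unitParam l h i o) - 1) ^ 2) ≤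
      affineDeviation μ σ := by
    rw [← Fintype.sum_prod_type']
    exact sum_comp_le_sum_of_injective (unitParam_injective2 l h).uncurry
      (f := fun k => μ k ^ 2 + (σ k - 1) ^ 2) fun k => by positivity
  calc preactGap (Measure.pi ν) φ μ σ x l h
      ≤ ∑ i, (2 * d + 4 * (∑ o, (μ (unitParam l h i o) ^ 2 + (σ (unitParam l h i o) - 1) ^ 2))
          * (F + d)) := Finset.sum_le_sum fun i _ => hunit i
    _ = 2 * (M * d) + 4 * (∑ i, ∑ o, (μ (unitParam l h i o) ^ 2
          + (σ (unitParam l h i o) - 1) ^ 2)) * (F + d) := by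
        rw [Finset.sum_add_distrib, Finset.sum_const, Finset.card_univ, Fintype.card_fin,
          nsmul_eq_mul, mul_left_comm, ← Finset.sum_mul, ← Finset.mul_sum]
    _ ≤ _ := by gcongr

lemma mul_inv_mul_le_self {a b : ℝ} (hb : 0 ≤ b) : a * (a⁻¹ * b) ≤ b := by
  rw [← mul_assoc]
  exact mul_le_of_le_one_left hb mul_inv_le_one

lemma preactGap_zero_le (hφ : LipschitzWith 1 φ) (x : EuclideanSpace ℝ (Fin Di)) (h : 0 < L) :
    preactGap (Measure.pi ν) φ μ σ x 0 h ≤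
      4 * affineDeviation μ σ * featureEnergy (Measure.pi ν) φ x 0 h.le := by
  simpa only [featureGap_zero, mul_zero, zero_add, add_zero] using
    preactGap_le (ν := ν) μ σ hφ x 0 h

lemma preactGap_succ_le (hφ : LipschitzWith 1 φ) (x : EuclideanSpace ℝ (Fin Di)) (l : ℕ)
    (h : l + 1 < L) :
    preactGap (Measure.pi ν) φ μ σ x (l + 1) h ≤
      2 * preactGap (Measure.pi ν) φ μ σ x l (Nat.lt_of_succ_lt h)
        + 4 * affineDeviation μ σ * (featureEnergy (Measure.pi ν) φ x (l + 1) h.le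
          + preactGap (Measure.pi ν) φ μ σ x l (Nat.lt_of_succ_lt h)) := by
  have hgap := featureGap_succ_le (ν := ν) μ σ hφ x l h.le
  have hD := preactGap_nonneg μ σ (Measure.pi ν) φ x l h.le
  have hK := affineDeviation_nonneg μ σ
  rw [one_div] at hgap
  refine (preactGap_le (ν := ν) μ σ hφ x (l + 1) h).trans ?_
  gcongr
  · exact (mul_le_mul_of_nonneg_left hgap M.cast_nonneg).trans (mul_inv_mul_le_self hD)
  · exact hgap.trans (mul_le_of_le_one_left hD M.cast_inv_le_one)

-- For `κ = 1` the bound in `hD` solves the extremal recursion `D' = 6 D + 4 K (2 ^ (n + 2) X)`.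
lemma gap_bound_step {K κ X F D D' : ℝ} (hK : 0 ≤ K) (hKκ : K ≤ κ) (hκ : 1 ≤ κ) (hX : 0 ≤ X)
    (hD_nonneg : 0 ≤ D) {n : ℕ} (hF : F ≤ 2 ^ (n + 2) * X)
    (hD : D ≤ 2 * K * X * κ ^ n * (6 ^ (n + 1) - 2 ^ (n + 1)))
    (hD' : D' ≤ 2 * D + 4 * K * (F + D)) :
    D' ≤ 2 * K * X * κ ^ (n + 1) * (6 ^ (n + 2) - 2 ^ (n + 2)) := by
  have hgrowth : 2 * D + 4 * K * D ≤ 6 * κ * D := by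
    linarith [mul_le_mul_of_nonneg_right hκ hD_nonneg, mul_le_mul_of_nonneg_right hKκ hD_nonneg]
  have hsource : 4 * K * F ≤ 2 * K * X * κ ^ (n + 1) * (2 * 2 ^ (n + 2)) := by
    calc 4 * K * F ≤ 4 * K * (2 ^ (n + 2) * X) := by gcongr
      _ = 2 * K * X * 1 * (2 * 2 ^ (n + 2)) := by ring
      _ ≤ _ := by
        gcongr
        exact one_le_pow₀ hκ
  calc D' ≤ 6 * κ * D + 4 * K * F := by linarith
    _ ≤ 6 * κ * (2 * K * X * κ ^ n * (6 ^ (n + 1) - 2 ^ (n + 1)))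
        + 2 * K * X * κ ^ (n + 1) * (2 * 2 ^ (n + 2)) := by gcongr
    _ = _ := by ring

lemma preactGap_le_geometric {κ : ℝ} (hφ : LipschitzWith 1 φ) (hκ : 1 ≤ κ)
    (hμσ : affineDeviation μ σ ≤ κ) (x : EuclideanSpace ℝ (Fin Di)) (l : ℕ) (h : l < L) :
    preactGap (Measure.pi ν) φ μ σ x l h ≤
      2 * affineDeviation μ σ * inputScale (φ 0) x * κ ^ l * (6 ^ (l + 1) - 2 ^ (l + 1)) := by
  have hK := affineDeviation_nonneg μ σ
  have hF := featureEnergy_le (ν := ν) hφ x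
  induction l with
  | zero =>
    calc _ ≤ 4 * affineDeviation μ σ * (2 ^ (0 + 1) * inputScale (φ 0) x) :=
          (preactGap_zero_le μ σ hφ x h).trans (by gcongr; exact hF 0 h.le)
      _ = _ := by ring
  | succ l ih =>
    exact gap_bound_step hK hμσ hκ (inputScale_pos _ x).le (preactGap_nonneg ..) (hF (l + 1) h.le)
      (ih (Nat.lt_of_succ_lt h)) (preactGap_succ_le μ σ hφ x l h)

end Coupling

section Output

lemma add_two_mul_sqrt_mul_sqrt_le {K κ X m e s : ℝ} {L : ℕ} (hK : 0 ≤ K) (hKκ : K ≤ κ)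
    (hκ : 1 ≤ κ) (hX : 0 ≤ X) (hm : 1 ≤ m) (he_nonneg : 0 ≤ e)
    (he : m * e ≤ 12 * K * X * (6 * κ) ^ L) (hs : s ≤ 2 ^ L * X) :
    e + 2 * (√e * √s) ≤ 20 * 6 ^ L * (X / √m) * √K * (√κ * κ ^ L) := by
  set Y := 6 ^ L * (X / √m) * √K * (√κ * κ ^ L) with hY
  have hm_pos : 0 < m := one_pos.trans_le hm
  have hY_nonneg : 0 ≤ Y := by positivity
  have he_div : e ≤ 12 * K * X * (6 * κ) ^ L / m := (le_div_iff₀' hm_pos).2 he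
  have he_le : e ≤ 12 * Y := by
    calc e ≤ 12 * K * X * (6 * κ) ^ L / m := he_div
      _ = 12 * 6 ^ L * (X / m) * (√K * √K) * κ ^ L := by
        rw [Real.mul_self_sqrt hK]
        ring
      _ ≤ 12 * 6 ^ L * (X / √m) * (√K * √κ) * κ ^ L := by
        gcongr
        exact Real.sqrt_le_self_iff.2 (.inr hm)
      _ = 12 * Y := by ring
  have hes_le : e * s ≤ (4 * Y) ^ 2 := by
    calc e * s ≤ 12 * K * X * (6 * κ) ^ L / m * (2 ^ L * X) :=
          (mul_le_mul_of_nonneg_left hs he_nonneg).trans (by gcongr)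
      _ = 12 * (6 ^ L * 2 ^ L) * (X ^ 2 / m) * K * (κ ^ L * 1) := by ring
      _ ≤ 16 * (6 ^ L * 6 ^ L) * (X ^ 2 / m) * K * (κ ^ L * (κ * κ ^ L)) := by
        gcongr
        · norm_num
        · norm_num
        · exact one_le_mul_of_one_le_of_one_le hκ (one_le_pow₀ hκ)
      _ = (4 * Y) ^ 2 := by
        rw [hY, ← Real.sq_sqrt hm_pos.le, ← Real.sq_sqrt hK, ← Real.sq_sqrt (hK.trans hKκ)]
        simp only [Real.sqrt_sq (Real.sqrt_nonneg _)]
        ring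
  have hsqrt : √e * √s ≤ 4 * Y := by
    rw [← Real.sqrt_mul he_nonneg]
    exact Real.sqrt_le_iff.2 ⟨mul_nonneg zero_le_four hY_nonneg, hes_le⟩
  linarith

variable {Di Do M L : ℕ} {φ : ℝ → ℝ} {ν : ParamIdx Di Do M L → Measure ℝ}
  [∀ k, IsStandardized (ν k)]

/-- Inputs of the output layer of `networkTilde`: the scaled activations of the last hidden layer,
centred by the even part `α` of `φ`. -/
noncomputable def centredFeature (hL : 1 ≤ L) (φ : ℝ → ℝ) (α : ℝ) (θ : Params Di Do M L)
    (x : EuclideanSpace ℝ (Fin Di)) (j : Fin M) : ℝ :=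
  1 / √(M : ℝ) * (φ (preact φ θ x (L - 1) (Nat.sub_one_lt_of_lt hL) j) - α)

lemma networkTilde_eq_sum_centredFeature (hL : 1 ≤ L) (φ : ℝ → ℝ) (α : ℝ)
    (θ : Params Di Do M L) (x : EuclideanSpace ℝ (Fin Di)) (i : Fin Do) :
    networkTilde hL φ α θ x i = ∑ j, θ (.outWeight i j) * centredFeature hL φ α θ x j := by
  simp only [networkTilde, network, centredFeature, mul_sub, Finset.sum_sub_distrib,
    Finset.mul_sum]
  rw [add_sub_right_comm, add_sub_cancel_right]
  congr! 2 <;> ring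

section Lipschitz

variable {K : ℝ≥0} (hL : 1 ≤ L) (hφ : LipschitzWith K φ) (x : EuclideanSpace ℝ (Fin Di)) (α : ℝ)
include hφ

lemma adaptedL2_reparam_centredFeature (μ σ : ParamIdx Di Do M L → ℝ) (j : Fin M) :
    AdaptedL2 (Measure.pi ν) (paramsBefore L) fun ω =>
      centredFeature hL φ α (reparam μ σ ω) x j := by
  have hpreact := adaptedL2_reparam_preact (ν := ν) (Nat.sub_one_lt_of_lt hL) j
    (adaptedL2_reparam_feature hφ μ σ x (L - 1) (Nat.sub_le L 1))
  rw [Nat.sub_add_cancel hL] at hpreact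
  exact .const_mul _ <| (hpreact.lipschitz_comp hφ).sub (.const _ α)

lemma adaptedL2_centredFeature (j : Fin M) :
    AdaptedL2 (Measure.pi ν) (paramsBefore L) fun ω => centredFeature hL φ α ω x j := by
  simpa only [reparam_zero_one] using adaptedL2_reparam_centredFeature hL hφ x α 0 1 j

lemma adaptedL2_reparam_networkTilde (μ σ : ParamIdx Di Do M L → ℝ) (i : Fin Do) :
    AdaptedL2 (Measure.pi ν) Set.univ fun ω => networkTilde hL φ α (reparam μ σ ω) x i := by
  simp only [networkTilde_eq_sum_centredFeature]
  exact .sum_reparam_mul μ σ (Set.subset_univ _) (outWeight_notMem_paramsBefore i)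
    (fun _ => Set.mem_univ _) (adaptedL2_reparam_centredFeature hL hφ x α μ σ)

lemma adaptedL2_networkTilde (i : Fin Do) :
    AdaptedL2 (Measure.pi ν) Set.univ fun ω => networkTilde hL φ α ω x i := by
  simpa only [reparam_zero_one] using adaptedL2_reparam_networkTilde hL hφ x α 0 1 i

end Lipschitz

variable (hL : 1 ≤ L) (hφ : LipschitzWith 1 φ) (x : EuclideanSpace ℝ (Fin Di))
include hφ

lemma integral_centredFeature_sq_le (j : Fin M) :
    ∫ ω, centredFeature hL φ (φ 0) ω x j ^ 2 ∂Measure.pi ν ≤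
      1 / (M : ℝ) * featureEnergy (Measure.pi ν) φ x (L - 1) (Nat.sub_le L 1) := by
  simp only [centredFeature, mul_pow, div_pow, one_pow, Real.sq_sqrt (Nat.cast_nonneg _),
    integral_const_mul]
  gcongr
  simpa [integral_preact_sq hφ] using integral_comp_sub_const_sq_le hφ
    (adaptedL2_preact (ν := ν) hφ x (L - 1) (Nat.sub_one_lt_of_lt hL) j).memLp

lemma integral_networkTilde_sq_le (i : Fin Do) :
    ∫ ω, networkTilde hL φ (φ 0) ω x i ^ 2 ∂Measure.pi ν ≤
      featureEnergy (Measure.pi ν) φ x (L - 1) (Nat.sub_le L 1) := by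
  have hmoment : ∫ ω, networkTilde hL φ (φ 0) ω x i ^ 2 ∂Measure.pi ν =
      ∑ j, ∫ ω, centredFeature hL φ (φ 0) ω x j ^ 2 ∂Measure.pi ν := by
    simpa [networkTilde_eq_sum_centredFeature] using
      AdaptedL2.integral_add_sum_eval_mul_sq (.const (paramsBefore L) 0)
        (adaptedL2_centredFeature (ν := ν) hL hφ x (φ 0)) (outWeight_notMem_paramsBefore i)
        (fun _ _ h => (ParamIdx.outWeight.inj h).2) Finset.univ
  have hsum := Finset.sum_le_card_nsmul Finset.univ _ _ fun j _ =>
    integral_centredFeature_sq_le (ν := ν) hL hφ x j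
  rw [Finset.card_univ, Fintype.card_fin, nsmul_eq_mul, one_div] at hsum
  exact hmoment.trans_le (hsum.trans (mul_inv_mul_le_self (featureEnergy_nonneg ..)))

lemma sum_integral_centredFeature_sub_sq_le (α : ℝ) (μ σ : ParamIdx Di Do M L → ℝ) :
    ∑ j, ∫ ω, (centredFeature hL φ α (reparam μ σ ω) x j
        - centredFeature hL φ α ω x j) ^ 2 ∂Measure.pi ν ≤
      1 / (M : ℝ) * preactGap (Measure.pi ν) φ μ σ x (L - 1) (Nat.sub_one_lt_of_lt hL) := by
  have hgap := featureGap_succ_le (ν := ν) μ σ hφ x (L - 1) (Nat.sub_one_lt_of_lt hL)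
  rw [featureGap_succ, Finset.mul_sum] at hgap
  simpa only [centredFeature, ← mul_sub, sub_sub_sub_cancel_right, mul_pow, div_pow, one_pow,
    Real.sq_sqrt (Nat.cast_nonneg _), integral_const_mul] using hgap

lemma pairwise_integral_centredFeature_mul [∀ k, (ν k).IsNegInvariant] {α : ℝ}
    (hα : ∀ a, evenPart φ a = α) :
    Pairwise fun j j' : Fin M =>
      ∫ ω, centredFeature hL φ α ω x j * centredFeature hL φ α ω x j' ∂Measure.pi ν = 0 := by
  intro j j' hjj'
  have ha := adaptedL2_feature (ν := ν) hφ x (L - 1) (Nat.sub_le L 1)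
  simp only [centredFeature, preact_eq_sum_feature]
  exact integral_odd_comp_sum_mul_odd_comp_sum (ψ := fun a => 1 / √(M : ℝ) * (φ a - α))
    ((hφ.continuous.measurable.sub_const α).const_mul _)
    (fun a => by simp only [sub_neg_of_evenPart_const hα, mul_neg])
    (fun o => (ha o).measurable) (fun o => (ha o).dependsOn)
    (unitParam_notMem_paramsBefore (L - 1) _) (unitParam_injective2 (L - 1) _) hjj'

lemma integral_sum_mul_centredFeature_sq_le [∀ k, (ν k).IsNegInvariant]
    (hα : ∀ a, evenPart φ a = φ 0) (m : Fin M → ℝ) :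
    ∫ ω, (∑ j, m j * centredFeature hL φ (φ 0) ω x j) ^ 2 ∂Measure.pi ν ≤
      (∑ j, m j ^ 2) *
        (1 / (M : ℝ) * featureEnergy (Measure.pi ν) φ x (L - 1) (Nat.sub_le L 1)) := by
  have horth := pairwise_integral_centredFeature_mul (ν := ν) hL hφ x hα
  rw [integral_sum_sq_of_orthogonal
    (fun j => ((adaptedL2_centredFeature hL hφ x (φ 0) j).const_mul (m j)).memLp)
    fun j j' hjj' => by
      simp only [mul_mul_mul_comm, integral_const_mul, horth hjj', mul_zero], Finset.sum_mul]
  simp only [mul_pow, integral_const_mul]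
  gcongr with j
  exact integral_centredFeature_sq_le hL hφ x j

lemma integral_reparam_networkTilde_sub_sq_le [∀ k, (ν k).IsNegInvariant]
    (hα : ∀ a, evenPart φ a = φ 0) (μ σ : ParamIdx Di Do M L → ℝ) (i : Fin Do) :
    M * ∫ ω, (networkTilde hL φ (φ 0) (reparam μ σ ω) x i
        - networkTilde hL φ (φ 0) ω x i) ^ 2 ∂Measure.pi ν ≤
      2 * preactGap (Measure.pi ν) φ μ σ x (L - 1) (Nat.sub_one_lt_of_lt hL)
        + 4 * affineDeviation μ σ
          * (featureEnergy (Measure.pi ν) φ x (L - 1) (Nat.sub_le L 1)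
            + preactGap (Measure.pi ν) φ μ σ x (L - 1) (Nat.sub_one_lt_of_lt hL)) := by
  set F := featureEnergy (Measure.pi ν) φ x (L - 1) (Nat.sub_le L 1)
  set D := preactGap (Measure.pi ν) φ μ σ x (L - 1) (Nat.sub_one_lt_of_lt hL)
  have hF_nonneg : 0 ≤ F := featureEnergy_nonneg ..
  have hD_nonneg : 0 ≤ D := preactGap_nonneg ..
  have hdev_nonneg := affineDeviation_nonneg μ σ
  have hinj : Function.Injective (ParamIdx.outWeight (Di := Di) (L := L) (M := M) i) :=
    fun _ _ h => (ParamIdx.outWeight.inj h).2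
  have hdev : ∑ j, (μ (.outWeight i j) ^ 2 + (σ (.outWeight i j) - 1) ^ 2) ≤
      affineDeviation μ σ :=
    sum_comp_le_sum_of_injective hinj (f := fun k => μ k ^ 2 + (σ k - 1) ^ 2)
      fun k => by positivity
  have hunit := AdaptedL2.integral_sum_affine_sub_sum_sq_le_of_le
    (adaptedL2_reparam_centredFeature (ν := ν) hL hφ x (φ 0) μ σ)
    (adaptedL2_centredFeature hL hφ x (φ 0)) (outWeight_notMem_paramsBefore i) hinj
    (fun j => μ (.outWeight i j)) (fun j => σ (.outWeight i j))
    (integral_centredFeature_sq_le hL hφ x) (integral_sum_mul_centredFeature_sq_le hL hφ x hα _)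
  simp only [networkTilde_eq_sum_centredFeature]
  calc _ ≤ (M : ℝ) * (2 * (1 / M * D) + 4 * affineDeviation μ σ * (1 / M * F + 1 / M * D)) := by
        refine mul_le_mul_of_nonneg_left (hunit.trans ?_) M.cast_nonneg
        have hgap := sum_integral_centredFeature_sub_sq_le (ν := ν) hL hφ x (φ 0) μ σ
        gcongr
    _ = M * ((M : ℝ)⁻¹ * (2 * D + 4 * affineDeviation μ σ * (F + D))) := by ring
    _ ≤ _ := mul_inv_mul_le_self (by positivity)

lemma integral_reparam_networkTilde_sub_sq_le_geometric [∀ k, (ν k).IsNegInvariant]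
    (hα : ∀ a, evenPart φ a = φ 0) {μ σ : ParamIdx Di Do M L → ℝ} {κ : ℝ} (hκ : 1 ≤ κ)
    (hμσ : affineDeviation μ σ ≤ κ) (i : Fin Do) :
    M * ∫ ω, (networkTilde hL φ (φ 0) (reparam μ σ ω) x i
        - networkTilde hL φ (φ 0) ω x i) ^ 2 ∂Measure.pi ν ≤
      12 * affineDeviation μ σ * inputScale (φ 0) x * (6 * κ) ^ L := by
  obtain ⟨n, rfl⟩ : ∃ n, L = n + 1 := Nat.exists_eq_add_of_le' hL
  have hK := affineDeviation_nonneg μ σ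
  have hX := inputScale_pos (φ 0) x
  have hF : featureEnergy (Measure.pi ν) φ x n n.le_succ ≤ 2 ^ (n + 2) * inputScale (φ 0) x := by
    refine (featureEnergy_le hφ x n n.le_succ).trans ?_
    gcongr <;> norm_num
  refine (gap_bound_step hK hμσ hκ hX.le (preactGap_nonneg ..) hF
    (preactGap_le_geometric μ σ hφ hκ hμσ x n n.lt_succ_self)
    (integral_reparam_networkTilde_sub_sq_le hL hφ x hα μ σ i)).trans ?_
  calc _ ≤ 2 * affineDeviation μ σ * inputScale (φ 0) x * κ ^ (n + 1) * 6 ^ (n + 2) := by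
        gcongr
        exact sub_le_self _ (by positivity)
    _ = _ := by ring

theorem abs_integral_reparam_networkTilde_sq_sub_le [∀ k, (ν k).IsNegInvariant] (hM : 1 ≤ M)
    (hα : ∀ a, evenPart φ a = φ 0) {μ σ : ParamIdx Di Do M L → ℝ} {κ : ℝ} (hκ : 1 ≤ κ)
    (hμσ : affineDeviation μ σ ≤ κ) (i : Fin Do) :
    |(∫ ω, networkTilde hL φ (φ 0) (reparam μ σ ω) x i ^ 2 ∂Measure.pi ν)
        - ∫ ω, networkTilde hL φ (φ 0) ω x i ^ 2 ∂Measure.pi ν| ≤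
      20 * 6 ^ L * (inputScale (φ 0) x / √(M : ℝ)) * √(affineDeviation μ σ) * (√κ * κ ^ L) := by
  refine (abs_integral_sq_sub_integral_sq_le
    (adaptedL2_reparam_networkTilde (ν := ν) hL hφ x (φ 0) μ σ i).memLp
    (adaptedL2_networkTilde hL hφ x (φ 0) i).memLp).trans ?_
  have he := integral_reparam_networkTilde_sub_sq_le_geometric (ν := ν) hL hφ x hα hκ hμσ i
  have hs := (integral_networkTilde_sq_le (ν := ν) hL hφ x i).trans
    (featureEnergy_le hφ x (L - 1) (Nat.sub_le L 1))
  rw [Nat.sub_add_cancel hL] at hs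
  exact add_two_mul_sqrt_mul_sqrt_le (affineDeviation_nonneg μ σ) hμσ hκ (inputScale_pos _ x).le
    (Nat.one_le_cast.2 hM) (integral_sq_nonneg _ _) he hs

end Output

section ExponentialDensity

lemma pi_withDensity {ι : Type*} [Fintype ι] {X : ι → Type*} [∀ i, MeasurableSpace (X i)]
    (ν : ∀ i, Measure (X i)) [∀ i, IsProbabilityMeasure (ν i)] {f : ∀ i, X i → ℝ≥0∞}
    (hf : ∀ i, Measurable (f i)) [∀ i, SigmaFinite ((ν i).withDensity (f i))] :
    Measure.pi (fun i => (ν i).withDensity (f i)) =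
      (Measure.pi ν).withDensity fun ω => ∏ i, f i (ω i) := by
  classical
  refine Measure.pi_eq fun s hs => ?_
  have hmeas (i : ι) : Measurable ((s i).indicator (f i)) := (hf i).indicator (hs i)
  have hindep := iIndepFun_pi (μ := ν) fun i => (hmeas i).aemeasurable
  have hprod : (Set.univ.pi s).indicator (fun ω => ∏ i, f i (ω i)) =
      fun ω => ∏ i, (s i).indicator (f i) (ω i) := by
    funext ω
    simp only [Set.indicator_apply, Set.mem_univ_pi, Finset.prod_ite_zero, Finset.mem_univ,
      true_imp_iff]
  rw [withDensity_apply _ (MeasurableSet.univ_pi hs),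
    ← lintegral_indicator (MeasurableSet.univ_pi hs), hprod,
    lintegral_prod_eq_prod_lintegral_of_indepFun Finset.univ _ hindep
      fun i => (hmeas i).comp (measurable_pi_apply i)]
  refine Finset.prod_congr rfl fun i _ => ?_
  rw [(measurePreserving_eval ν i).lintegral_comp (hmeas i), lintegral_indicator (hs i),
    withDensity_apply _ (hs i)]

variable {Ω : Type*} [MeasurableSpace Ω] {ρ ν : Measure Ω} {ℓ : Ω → ℝ}

lemma llr_ae_eq_of_eq_withDensity_exp [SigmaFinite ν] (hℓ : Measurable ℓ)
    (hρ : ρ = ν.withDensity fun ω => .ofReal (Real.exp (ℓ ω))) : llr ρ ν =ᵐ[ρ] ℓ := by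
  have hac : ρ ≪ ν := hρ ▸ withDensity_absolutelyContinuous _ _
  have hderiv := Measure.rnDeriv_withDensity ν hℓ.exp.ennreal_ofReal
  rw [← hρ] at hderiv
  filter_upwards [hac.ae_le hderiv] with ω hω
  rw [llr, hω, ENNReal.toReal_ofReal (Real.exp_pos _).le, Real.log_exp]

lemma klDiv_ne_top_of_eq_withDensity_exp [SigmaFinite ν] (hℓ : Measurable ℓ)
    (hρ : ρ = ν.withDensity fun ω => .ofReal (Real.exp (ℓ ω))) (hint : Integrable ℓ ρ) :
    InformationTheory.klDiv ρ ν ≠ ∞ :=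
  InformationTheory.klDiv_ne_top (hρ ▸ withDensity_absolutelyContinuous _ _)
    ((integrable_congr (llr_ae_eq_of_eq_withDensity_exp hℓ hρ)).2 hint)

lemma toReal_klDiv_of_eq_withDensity_exp [IsProbabilityMeasure ρ] [IsProbabilityMeasure ν]
    (hℓ : Measurable ℓ) (hρ : ρ = ν.withDensity fun ω => .ofReal (Real.exp (ℓ ω))) :
    (InformationTheory.klDiv ρ ν).toReal = ∫ ω, ℓ ω ∂ρ := by
  rw [InformationTheory.toReal_klDiv_of_measure_eq (hρ ▸ withDensity_absolutelyContinuous _ _)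
    (by simp), integral_congr_ae (llr_ae_eq_of_eq_withDensity_exp hℓ hρ)]

end ExponentialDensity

section GaussianDensity

/-- Logarithm of the density of `N(m, w)` with respect to `N(0, 1)`. -/
noncomputable def gaussianLogRatio (m : ℝ) (w : ℝ≥0) (y : ℝ) : ℝ :=
  -(Real.log w / 2) - (y - m) ^ 2 / (2 * w) + y ^ 2 / 2

lemma measurable_gaussianLogRatio (m : ℝ) (w : ℝ≥0) : Measurable (gaussianLogRatio m w) := by
  unfold gaussianLogRatio
  fun_prop

lemma gaussianPDFReal_eq_mul_exp_gaussianLogRatio (m : ℝ) {w : ℝ≥0} (hw : 0 < w) (y : ℝ) :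
    gaussianPDFReal m w y = gaussianPDFReal 0 1 y * Real.exp (gaussianLogRatio m w y) := by
  have hw' : (0 : ℝ) < w := hw
  have hsqrt : (√(2 * Real.pi * w))⁻¹ = (√(2 * Real.pi))⁻¹ * Real.exp (-(Real.log w / 2)) := by
    rw [Real.exp_neg, ← Real.log_sqrt hw'.le, Real.exp_log (Real.sqrt_pos.2 hw'), ← mul_inv,
      Real.sqrt_mul (by positivity)]
  rw [gaussianPDFReal, gaussianPDFReal, hsqrt, NNReal.coe_one, mul_one, mul_assoc, mul_assoc,
    ← Real.exp_add, ← Real.exp_add]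
  congr 2
  rw [gaussianLogRatio]
  ring

lemma gaussianReal_eq_withDensity_exp (m : ℝ) {w : ℝ≥0} (hw : 0 < w) :
    gaussianReal m w = (gaussianReal 0 1).withDensity
      fun y => .ofReal (Real.exp (gaussianLogRatio m w y)) := by
  rw [gaussianReal_of_var_ne_zero _ hw.ne', gaussianReal_of_var_ne_zero _ one_ne_zero,
    ← withDensity_mul _ (measurable_gaussianPDF _ _)
      (measurable_gaussianLogRatio m w).exp.ennreal_ofReal]
  congr 1 with y
  rw [Pi.mul_apply, gaussianPDF, gaussianPDF, ← ENNReal.ofReal_mul (gaussianPDFReal_nonneg _ _ _),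
    gaussianPDFReal_eq_mul_exp_gaussianLogRatio m hw]

lemma integrable_id_gaussianReal (m : ℝ) (w : ℝ≥0) :
    Integrable (fun y => y) (gaussianReal m w) :=
  (memLp_id_gaussianReal' (μ := m) (v := w) 1 (by simp)).integrable le_rfl

lemma integrable_sq_gaussianReal (m : ℝ) (w : ℝ≥0) :
    Integrable (fun y => y ^ 2) (gaussianReal m w) :=
  (memLp_id_gaussianReal' (μ := m) (v := w) 2 (by simp)).integrable_sq

lemma integral_sq_gaussianReal (m : ℝ) (w : ℝ≥0) :
    ∫ y, y ^ 2 ∂gaussianReal m w = w + m ^ 2 := by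
  have hvar := variance_eq_sub (memLp_id_gaussianReal' (μ := m) (v := w) 2 (by simp))
  simp only [variance_id_gaussianReal, Pi.pow_apply, id_eq, integral_id_gaussianReal] at hvar
  linarith

lemma gaussianReal_zero_one_map_affine (m : ℝ) (w : ℝ≥0) :
    (gaussianReal 0 1).map (fun y => m + √w * y) = gaussianReal m w := by
  have hcomp : (fun y => m + √w * y) = (m + ·) ∘ (√w * ·) := rfl
  rw [hcomp, ← Measure.map_map (by fun_prop) (by fun_prop), gaussianReal_map_const_mul,
    gaussianReal_map_const_add, mul_zero, zero_add, mul_one]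
  congr 1
  exact NNReal.coe_injective (Real.sq_sqrt w.coe_nonneg)

lemma gaussianLogRatio_eq_quadratic (m : ℝ) (w : ℝ≥0) :
    gaussianLogRatio m w = fun y => (1 / 2 - 1 / (2 * (w : ℝ))) * y ^ 2 + m / w * y
      + (-(Real.log w / 2) - m ^ 2 / (2 * w)) := by
  ext y
  unfold gaussianLogRatio
  ring

lemma integrable_gaussianLogRatio (m : ℝ) (w : ℝ≥0) :
    Integrable (gaussianLogRatio m w) (gaussianReal m w) := by
  rw [gaussianLogRatio_eq_quadratic]
  exact (((integrable_sq_gaussianReal m w).const_mul _).add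
    ((integrable_id_gaussianReal m w).const_mul _)).add (integrable_const _)

lemma integral_gaussianLogRatio (m : ℝ) {w : ℝ≥0} (hw : 0 < w) :
    ∫ y, gaussianLogRatio m w y ∂gaussianReal m w = (m ^ 2 + w - 1 - Real.log w) / 2 := by
  have hw' : (w : ℝ) ≠ 0 := by exact_mod_cast hw.ne'
  have hsq := integrable_sq_gaussianReal m w
  have hid := integrable_id_gaussianReal m w
  rw [gaussianLogRatio_eq_quadratic,
    integral_add (by exact (hsq.const_mul _).add (hid.const_mul _)) (integrable_const _),
    integral_add (hsq.const_mul _) (hid.const_mul _), integral_const_mul, integral_const_mul,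
    integral_sq_gaussianReal, integral_id_gaussianReal, integral_const, probReal_univ, one_smul]
  field_simp
  ring

lemma sq_sqrt_sub_one_le {w : ℝ} (hw : 0 < w) : (√w - 1) ^ 2 ≤ w - 1 - Real.log w := by
  have hlog := Real.log_le_sub_one_of_pos (Real.sqrt_pos.2 hw)
  rw [Real.log_sqrt hw.le] at hlog
  linarith [Real.sq_sqrt hw.le, sub_sq (√w) 1]

end GaussianDensity

section MeanField

variable {ι : Type} [Fintype ι] (μ : ι → ℝ) (v : ι → ℝ≥0)

instance : IsProbabilityMeasure (meanFieldGaussian μ v) := by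
  unfold meanFieldGaussian
  infer_instance

instance : IsProbabilityMeasure (stdPrior ι) := by
  unfold stdPrior
  infer_instance

lemma map_reparam_stdPrior :
    (stdPrior ι).map (reparam μ fun k => √(v k)) = meanFieldGaussian μ v := by
  unfold stdPrior meanFieldGaussian reparam
  rw [Measure.pi_map_pi (f := fun k y => μ k + √(v k) * y) fun k => by fun_prop]
  exact congrArg Measure.pi (funext fun k => gaussianReal_zero_one_map_affine (μ k) (v k))

variable {v}

lemma meanFieldGaussian_eq_withDensity_exp (hv : ∀ i, 0 < v i) :
    meanFieldGaussian μ v = (stdPrior ι).withDensity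
      fun ω => .ofReal (Real.exp (∑ i, gaussianLogRatio (μ i) (v i) (ω i))) := by
  have hdensity (i : ι) := gaussianReal_eq_withDensity_exp (μ i) (hv i)
  have (i : ι) : SigmaFinite ((gaussianReal 0 1).withDensity
      fun y => .ofReal (Real.exp (gaussianLogRatio (μ i) (v i) y))) :=
    hdensity i ▸ inferInstance
  simp only [Real.exp_sum, ENNReal.ofReal_prod_of_nonneg fun _ _ => (Real.exp_pos _).le]
  rw [meanFieldGaussian, stdPrior, meanFieldGaussian, ← pi_withDensity _
    fun i => (measurable_gaussianLogRatio (μ i) (v i)).exp.ennreal_ofReal]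
  exact congrArg Measure.pi (funext hdensity)

lemma measurable_sum_gaussianLogRatio :
    Measurable fun ω : ι → ℝ => ∑ i, gaussianLogRatio (μ i) (v i) (ω i) :=
  Finset.measurable_sum _ fun _ _ => (measurable_gaussianLogRatio _ _).comp (measurable_pi_apply _)

lemma integrable_gaussianLogRatio_eval (i : ι) :
    Integrable (fun ω => gaussianLogRatio (μ i) (v i) (ω i)) (meanFieldGaussian μ v) :=
  integrable_comp_eval (integrable_gaussianLogRatio (μ i) (v i))

theorem klDiv_meanFieldGaussian_stdPrior_ne_top (hv : ∀ i, 0 < v i) :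
    InformationTheory.klDiv (meanFieldGaussian μ v) (stdPrior ι) ≠ ∞ :=
  klDiv_ne_top_of_eq_withDensity_exp (measurable_sum_gaussianLogRatio μ)
    (meanFieldGaussian_eq_withDensity_exp μ hv)
    (integrable_finsetSum _ fun i _ => integrable_gaussianLogRatio_eval μ i)

theorem toReal_klDiv_meanFieldGaussian_stdPrior (hv : ∀ i, 0 < v i) :
    (InformationTheory.klDiv (meanFieldGaussian μ v) (stdPrior ι)).toReal =
      ∑ i, (μ i ^ 2 + v i - 1 - Real.log (v i)) / 2 := by
  rw [toReal_klDiv_of_eq_withDensity_exp (measurable_sum_gaussianLogRatio μ)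
    (meanFieldGaussian_eq_withDensity_exp μ hv),
    integral_finsetSum _ fun i _ => integrable_gaussianLogRatio_eval μ i]
  refine Finset.sum_congr rfl fun i _ => ?_
  exact (integral_comp_eval (measurable_gaussianLogRatio _ _).aestronglyMeasurable).trans
    (integral_gaussianLogRatio (μ i) (hv i))

lemma affineDeviation_sqrt_le_two_mul_toReal_klDiv (hv : ∀ i, 0 < v i) :
    affineDeviation μ (fun k => √(v k)) ≤
      2 * (InformationTheory.klDiv (meanFieldGaussian μ v) (stdPrior ι)).toReal := by
  rw [toReal_klDiv_meanFieldGaussian_stdPrior μ hv, affineDeviation, Finset.mul_sum]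
  gcongr with i
  linarith [sq_sqrt_sub_one_le (NNReal.coe_pos.2 (hv i))]

end MeanField

section GaussianNetwork

instance : IsStandardized (gaussianReal 0 1) where
  memLp_id := memLp_id_gaussianReal' 2 (by simp)
  integral_id := integral_id_gaussianReal
  integral_sq := by simp [integral_sq_gaussianReal]

instance : (gaussianReal 0 1).IsNegInvariant :=
  ⟨by rw [Measure.neg_def, gaussianReal_map_neg, neg_zero]⟩

variable {Di Do M L : ℕ} {φ : ℝ → ℝ} (hL : 1 ≤ L) (x : EuclideanSpace ℝ (Fin Di)) (α : ℝ)
  (μ : ParamIdx Di Do M L → ℝ) (v : ParamIdx Di Do M L → ℝ≥0) (i : Fin Do)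

lemma measurable_networkTilde_sq {K : ℝ≥0} (hφ : LipschitzWith K φ) :
    Measurable fun θ : Params Di Do M L => networkTilde hL φ α θ x i ^ 2 :=
  (adaptedL2_networkTilde (ν := fun _ => gaussianReal 0 1) hL hφ x α i).measurable.pow_const 2

lemma integrable_networkTilde_sq_meanFieldGaussian {K : ℝ≥0} (hφ : LipschitzWith K φ) :
    Integrable (fun θ => networkTilde hL φ α θ x i ^ 2) (meanFieldGaussian μ v) := by
  rw [← map_reparam_stdPrior, integrable_map_measure
    (measurable_networkTilde_sq hL x α i hφ).aestronglyMeasurable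
    (measurable_reparam _ _).aemeasurable]
  exact (adaptedL2_reparam_networkTilde (ν := fun _ => gaussianReal 0 1)
    hL hφ x α μ (fun k => √(v k)) i).memLp.integrable_sq

lemma integral_networkTilde_sq_meanFieldGaussian {K : ℝ≥0} (hφ : LipschitzWith K φ) :
    ∫ θ, networkTilde hL φ α θ x i ^ 2 ∂meanFieldGaussian μ v =
      ∫ ω, networkTilde hL φ α (reparam μ (fun k => √(v k)) ω) x i ^ 2
        ∂stdPrior (ParamIdx Di Do M L) := by
  rw [← map_reparam_stdPrior, integral_map (measurable_reparam _ _).aemeasurable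
    (measurable_networkTilde_sq hL x α i hφ).aestronglyMeasurable]

variable {α} {v}

theorem norm_integral_networkTilde_sq_sub_le (hM : 1 ≤ M) (hφ : LipschitzWith 1 φ)
    (hα : ∀ a, evenPart φ a = α) (hv : ∀ k, 0 < v k) {KL : ℝ}
    (hKL : (InformationTheory.klDiv (meanFieldGaussian μ v)
      (stdPrior (ParamIdx Di Do M L))).toReal = KL) :
    ‖(fun i => (∫ θ, networkTilde hL φ α θ x i ^ 2 ∂meanFieldGaussian μ v)
        - ∫ θ, networkTilde hL φ α θ x i ^ 2 ∂stdPrior (ParamIdx Di Do M L) : Fin Do → ℝ)‖ ≤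
      20 * √2 * 6 ^ L * (inputScale α x / √(M : ℝ)) * √KL
        * (max (2 * KL) 1) ^ ((L : ℝ) + 1 / 2) := by
  obtain rfl : φ 0 = α := evenPart_const_apply_zero hα
  have hdev : affineDeviation μ (fun k => √(v k)) ≤ 2 * KL :=
    hKL ▸ affineDeviation_sqrt_le_two_mul_toReal_klDiv μ hv
  have hX := inputScale_pos (φ 0) x
  have hκ : 0 < max (2 * KL) 1 := lt_max_of_lt_right one_pos
  have hpow : max (2 * KL) 1 ^ ((L : ℝ) + 1 / 2) = √(max (2 * KL) 1) * max (2 * KL) 1 ^ L := by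
    rw [Real.rpow_add hκ, Real.rpow_natCast, ← Real.sqrt_eq_rpow, mul_comm]
  refine (pi_norm_le_iff_of_nonneg (by positivity)).2 fun i => ?_
  rw [Real.norm_eq_abs, integral_networkTilde_sq_meanFieldGaussian hL x (φ 0) μ v i hφ, hpow]
  calc _ ≤ 20 * 6 ^ L * (inputScale (φ 0) x / √(M : ℝ))
          * √(affineDeviation μ fun k => √(v k))
          * (√(max (2 * KL) 1) * max (2 * KL) 1 ^ L) :=
        abs_integral_reparam_networkTilde_sq_sub_le (ν := fun _ => gaussianReal 0 1) hL hφ x hM hα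
          (le_max_right _ _) (hdev.trans (le_max_left _ _)) i
    _ ≤ 20 * 6 ^ L * (inputScale (φ 0) x / √(M : ℝ)) * √(2 * KL)
          * (√(max (2 * KL) 1) * max (2 * KL) 1 ^ L) := by gcongr
    _ = _ := by
        rw [Real.sqrt_mul zero_le_two]
        ring

end GaussianNetwork

section Constants

lemma cOne_bounds : 51 < cOne ∧ cOne < 52 := by
  have hlower : 1.41 < √2 := Real.lt_sqrt_of_sq_lt (by norm_num)
  have hupper : √2 < 1.42 := (Real.sqrt_lt' (by norm_num)).2 (by norm_num)
  unfold cOne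
  constructor <;> linarith

lemma rho_bounds_of_mem {ρ α : ℝ} {M : ℕ} (h : ρ = rho α M ∨ ρ = rhoSwap α M) :
    17 < ρ ∧ ρ < 97 := by
  have : 2 < √(2 * Real.pi) := Real.lt_sqrt_of_sq_lt (by linarith [Real.pi_gt_three])
  have : √(2 * Real.pi) < 3 := (Real.sqrt_lt' (by norm_num)).2 (by linarith [Real.pi_lt_four])
  have : 6.5 < √43 := Real.lt_sqrt_of_sq_lt (by norm_num)
  have : √43 < 7 := (Real.sqrt_lt' (by norm_num)).2 (by norm_num)
  have : 28 < √793 := Real.lt_sqrt_of_sq_lt (by norm_num)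
  have : √793 < 29 := (Real.sqrt_lt' (by norm_num)).2 (by norm_num)
  have : 48 < √2353 := Real.lt_sqrt_of_sq_lt (by norm_num)
  have : √2353 < 49 := (Real.sqrt_lt' (by norm_num)).2 (by norm_num)
  rcases h with rfl | rfl
  · unfold rho
    split_ifs <;> constructor <;> linarith
  · unfold rhoSwap
    split_ifs <;> constructor <;> linarith

lemma twenty_mul_sqrt_two_mul_six_pow_le {ρ : ℝ} {L : ℕ} (hL : 1 ≤ L) (hρ : 6 ≤ ρ) :
    20 * √2 * 6 ^ L ≤ cOne * (L : ℝ) ^ (1 / 2 : ℝ) * ρ ^ L := by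
  have hdepth : 1 ≤ (L : ℝ) ^ (1 / 2 : ℝ) :=
    Real.one_le_rpow (Nat.one_le_cast.2 hL) (by norm_num)
  have hcOne : 20 * √2 ≤ cOne := by
    unfold cOne
    linarith [Real.sqrt_nonneg 2]
  have hcOne_nonneg : 0 ≤ cOne := hcOne.trans' (by positivity)
  calc 20 * √2 * 6 ^ L ≤ cOne * ρ ^ L := by gcongr
    _ = cOne * 1 * ρ ^ L := by rw [mul_one]
    _ ≤ cOne * (L : ℝ) ^ (1 / 2 : ℝ) * ρ ^ L := by
      have : 0 ≤ ρ := hρ.trans' (by norm_num)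
      gcongr

end Constants

theorem mainTheorem3 {Di Do M L : ℕ} (hDi : 1 ≤ Di) (hM : 1 ≤ M) (hL : 1 ≤ L)
    (φ : ℝ → ℝ) (hφ : LipschitzWith 1 φ) (α : ℝ) (hα : ∀ a, evenPart φ a = α)
    (μ : ParamIdx Di Do M L → ℝ) (v : ParamIdx Di Do M L → ℝ≥0) (hv : ∀ i, 0 < v i)
    (Q P : Measure (Params Di Do M L))
    (hQ : Q = meanFieldGaussian μ v) (hP : P = stdPrior (ParamIdx Di Do M L))
    (x : EuclideanSpace ℝ (Fin Di)) :
    InformationTheory.klDiv Q P ≠ ∞ ∧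
    (∀ i, Integrable (fun θ => networkTilde hL φ α θ x i ^ 2) Q) ∧
    (∀ i, Integrable (fun θ => networkTilde hL φ α θ x i ^ 2) P) ∧
    (51 < cOne ∧ cOne < 52) ∧
    ∀ ρ : ℝ, ρ = rho α M ∨ ρ = rhoSwap α M →
      (17 < ρ ∧ ρ < 97) ∧
      ‖(fun i => (∫ θ, networkTilde hL φ α θ x i ^ 2 ∂Q)
          - ∫ θ, networkTilde hL φ α θ x i ^ 2 ∂P : Fin Do → ℝ)‖
        ≤ cOne * (L : ℝ) ^ (1 / 2 : ℝ) * ρ ^ L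
          * ((α ^ 2 + 1 + 1 / (Di : ℝ) * ‖x‖ ^ 2) / √(M : ℝ))
          * √(InformationTheory.klDiv Q P).toReal
          * (max (2 * (InformationTheory.klDiv Q P).toReal) 1) ^ ((L : ℝ) + 1 / 2) := by
  subst hQ hP
  refine ⟨klDiv_meanFieldGaussian_stdPrior_ne_top μ hv,
    fun i => integrable_networkTilde_sq_meanFieldGaussian hL x α μ v i hφ,
    fun i => integrable_networkTilde_sq_meanFieldGaussian hL x α _ _ i hφ,
    cOne_bounds, fun ρ hρ => ⟨rho_bounds_of_mem hρ, ?_⟩⟩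
  refine (norm_integral_networkTilde_sq_sub_le hL x μ hM hφ hα hv rfl).trans ?_
  have hcoef := twenty_mul_sqrt_two_mul_six_pow_le hL (ρ := ρ) (by linarith [rho_bounds_of_mem hρ])
  unfold inputScale
  gcongr
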